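/- Let $n\ge 2$ and let $M$ be a smooth (Hausdorff) $(n+1)$-dimensional manifold with a transversely oriented codimension-one foliation $\mathcal F$. For a Riemannian metric $g$ on $M$ let $\nabla$ be its Levi-Civita connection, $N$ the positively oriented $g$-unit normal field of $\mathcal F$, $A$ the Weingarten operator, $A(X)=-\nabla_XN$ for $X\in T\mathcal F$, extended by $A(N)=0$, and let $\tau_i=\operatorname{tr}\big((A|_{T\mathcal F})^i\big)=k_1^i+\dots+k_n^i$ $(i\ge0)$ be the power sums of the principal curvatures $k_1,\dots,k_n$ of the leaves. Let $\hat b_j(X,Y)=g(A^j\hat X,\hat Y)$, where $\hat X=X-g(X,N)N$. Let $\varepsilon>0$ and let $g_t$, $t\in[0,\varepsilon)$, be a family of Riemannian metrics, smooth on $M\times[0,\varepsilon)$, which is an extrinsic geometric flow $$\partial_t g_t=\sum_{j=0}^{n-1}f_j\,\hat b_j^{\,t}\qquad\text{with } f_1=C \text{ constant and } f_j=0 \text{ for } j\neq1,$$ where $\hat b_j^{\,t}$ is formed with respect to $g_t$. Denote by $\tau_i^t$ the power sums for $g_t$, by $N$ the unit normal for $g_0$, and by $(\phi_s)$ the flow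 of the vector field $\partial_t+\frac C2N$ on $M\times\mathbb R$. Identify $M$ with each slice $M\times\{t\}$. Then: 1. for all $i\ge0$ and $t\in[0,\varepsilon)$, $\phi_{-t}$ maps $M\times\{t\}$ into $M\times\{0\}$ and $$\tau_i^t=\tau_i^0\circ\phi_{-t};$$ if the flow is only local, this holds at each point $(p,t)$ at which $\phi_{-t}$ is defined; 2. if $M$ is compact or, more generally, $N$ is complete, then $\phi$ is globally defined, and if $\tau_i^0$ is constant on $M$ for some $i$, then for all $t\in[0,\varepsilon)$ the function $\tau_i^t$ is constant, with the same value. -/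

import Mathlib

open scoped Manifold ContDiff

noncomputable section

namespace EGF

open Bundle Set Filter Topology VectorField

section LeviCivita

set_option linter.unusedSectionVars false

variable {E : Type*} [NormedAddCommGroup E] [NormedSpace ℝ E] [FiniteDimensional ℝ E] [CompleteSpace E]
  {H : Type*} [TopologicalSpace H] {I : ModelWithCorners ℝ E H}
  {M : Type*} [TopologicalSpace M] [ChartedSpace H M] [IsManifold I ∞ M]

theorem metric_mdiffAt (g : ContMDiffRiemannianMetric I ∞ E (fun p : M => TangentSpace I p))
    {X Y : (p : M) → TangentSpace I p} {x : M} (hX : MDiffAt (T% X) x) (hY : MDiffAt (T% Y) x) :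
    MDiffAt (fun x => g.inner x (X x) (Y x)) x := by
  have h : MDifferentiableAt I (I.prod 𝓘(ℝ, ℝ))
      (fun m : M => TotalSpace.mk' ℝ (E := Bundle.Trivial M ℝ) m (g.inner m (X m) (Y m))) x := by
    apply MDifferentiableAt.clm_bundle_apply₂ (F₁ := E) (F₂ := E)
    · exact (g.contMDiff x).mdifferentiableAt (by simp)
    · exact hX
    · exact hY
  simp only [mdifferentiableAt_totalSpace] at h
  exact h.2

/-- The right-hand side of the Koszul formula for `g(∇_X Y, Z)` at `x`. -/
def koszulForm (g : ContMDiffRiemannianMetric I ∞ E (fun p : M => TangentSpace I p))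
    (X Y Z : (p : M) → TangentSpace I p) (x : M) : ℝ :=
  (1 / 2) * (d% (fun p => g.inner p (Y p) (Z p)) x (X x)
    + d% (fun p => g.inner p (X p) (Z p)) x (Y x)
    - d% (fun p => g.inner p (X p) (Y p)) x (Z x)
    + g.inner x (mlieBracket I X Y x) (Z x)
    - g.inner x (mlieBracket I X Z x) (Y x)
    - g.inner x (mlieBracket I Y Z x) (X x))

variable (g : ContMDiffRiemannianMetric I ∞ E (fun p : M => TangentSpace I p))

theorem koszul_tensorialX {Y Z : (p : M) → TangentSpace I p} {x : M}
    (hY : MDiffAt (T% Y) x) (hZ : MDiffAt (T% Z) x) :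
    TensorialAt I E (fun X => koszulForm g X Y Z x) x where
  smul {f X} hf hX := by
    have e1 : (fun p => g.inner p ((f • X) p) (Z p)) = f * (fun p => g.inner p (X p) (Z p)) := by
      ext p; simp
    have e2 : (fun p => g.inner p ((f • X) p) (Y p)) = f * (fun p => g.inner p (X p) (Y p)) := by
      ext p; simp
    simp only [koszulForm, e1, e2, mvfderiv_mul hf (metric_mdiffAt g hX hZ),
      mvfderiv_mul hf (metric_mdiffAt g hX hY), mlieBracket_smul_left hf hX]
    simp [g.symm x (X x)]
    ring
  add {X X'} hX hX' := by
    have e1 (Z : (p : M) → TangentSpace I p) : (fun p => g.inner p ((X + X') p) (Z p)) =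
      (fun p => g.inner p (X p) (Z p)) + (fun p => g.inner p (X' p) (Z p)) := by
      ext p; simp
    simp only [koszulForm, e1, mvfderiv_add (metric_mdiffAt g hX hZ) (metric_mdiffAt g hX' hZ),
      mvfderiv_add (metric_mdiffAt g hX hY) (metric_mdiffAt g hX' hY), mlieBracket_add_left hX hX']
    simp
    ring

theorem koszul_tensorialZ {X Y : (p : M) → TangentSpace I p} {x : M}
    (hX : MDiffAt (T% X) x) (hY : MDiffAt (T% Y) x) :
    TensorialAt I E (fun Z => koszulForm g X Y Z x) x where
  smul {f Z} hf hZ := by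
    have e1 (X : (p : M) → TangentSpace I p) : (fun p => g.inner p (X p) ((f • Z) p)) = f * (fun p => g.inner p (X p) (Z p)) := by
      ext p; simp
    simp only [koszulForm, e1, mvfderiv_mul hf (metric_mdiffAt g hX hZ),
      mvfderiv_mul hf (metric_mdiffAt g hY hZ), mlieBracket_smul_right hf hZ]
    simp [g.symm x (Z x)]
    ring
  add {Z Z'} hZ hZ' := by
    have e1 (X : (p : M) → TangentSpace I p) : (fun p => g.inner p (X p) ((Z + Z') p)) =
      (fun p => g.inner p (X p) (Z p)) + (fun p => g.inner p (X p) (Z' p)) := by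
      ext p; simp
    simp only [koszulForm, e1, mvfderiv_add (metric_mdiffAt g hX hZ) (metric_mdiffAt g hX hZ'),
      mvfderiv_add (metric_mdiffAt g hY hZ) (metric_mdiffAt g hY hZ'), mlieBracket_add_right hZ hZ']
    simp
    ring


/-- The musical isomorphism `v ↦ g(v, ·)`. -/
def metricFlat (x : M) : TangentSpace I x ≃ₗ[ℝ] (TangentSpace I x →L[ℝ] ℝ) :=
  haveI : FiniteDimensional ℝ (TangentSpace I x) := inferInstanceAs (FiniteDimensional ℝ E)
  haveI : T2Space (TangentSpace I x) := inferInstanceAs (T2Space E)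
  LinearEquiv.ofInjectiveOfFinrankEq (g.inner x).toLinearMap
    (by
      rw [injective_iff_map_eq_zero]
      intro v hv
      by_contra h
      have h1 := g.pos x v h
      have h2 : g.inner x v v = 0 := by
        have := congrArg (fun L : TangentSpace I x →L[ℝ] ℝ => L v) hv
        simpa using this
      linarith)
    (by
      have := (LinearMap.toContinuousLinearMap (𝕜 := ℝ) (E := TangentSpace I x)
        (F' := ℝ)).finrank_eq
      rw [← this]
      exact (Subspace.dual_finrank_eq (K := ℝ) (V := TangentSpace I x)).symm)

theorem metricFlat_apply (x : M) (v w : TangentSpace I x) :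
    metricFlat g x v w = g.inner x v w := rfl

theorem inner_metricFlat_symm (x : M) (L : TangentSpace I x →L[ℝ] ℝ) (w : TangentSpace I x) :
    g.inner x ((metricFlat g x).symm L) w = L w := by
  rw [← metricFlat_apply, LinearEquiv.apply_symm_apply]

theorem metric_ext {x : M} {u v : TangentSpace I x}
    (h : ∀ w, g.inner x u w = g.inner x v w) : u = v :=
  (metricFlat g x).injective (ContinuousLinearMap.ext h)

open scoped Classical in
/-- `leviCivitaFun g Y x v` is `∇_v Y`, determined by the Koszul formula (value `0` if `Y` is not
differentiable at `x`). -/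
def leviCivitaFun (Y : (p : M) → TangentSpace I p) (x : M) :
    TangentSpace I x →L[ℝ] TangentSpace I x :=
  haveI : FiniteDimensional ℝ (TangentSpace I x) := inferInstanceAs (FiniteDimensional ℝ E)
  haveI : T2Space (TangentSpace I x) := inferInstanceAs (T2Space E)
  if hY : MDiffAt (T% Y) x then
    LinearMap.toContinuousLinearMap ((metricFlat g x).symm.toLinearMap ∘ₗ
      (TensorialAt.mkHom₂ (I := I) (F := E) (F' := E) (fun X Z => koszulForm g X Y Z x) x
        (fun _ hZ => koszul_tensorialX g hY hZ)
        (fun _ hX => koszul_tensorialZ g hX hY)).toLinearMap)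
  else 0

theorem inner_leviCivitaFun {X Y Z : (p : M) → TangentSpace I p} {x : M}
    (hX : MDiffAt (T% X) x) (hY : MDiffAt (T% Y) x) (hZ : MDiffAt (T% Z) x) :
    g.inner x (leviCivitaFun g Y x (X x)) (Z x) = koszulForm g X Y Z x := by
  simp only [leviCivitaFun, hY, dif_pos]
  refine (inner_metricFlat_symm g x _ (Z x)).trans ?_
  exact TensorialAt.mkHom₂_apply (I := I) (F := E) (F' := E)
    (Φ := fun X Z => koszulForm g X Y Z x)
    (fun _ hZ => koszul_tensorialX g hY hZ) (fun _ hX => koszul_tensorialZ g hX hY) hX hZ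

theorem leviCivita_eq {X Y : (p : M) → TangentSpace I p} {x : M}
    (hX : MDiffAt (T% X) x) (hY : MDiffAt (T% Y) x) {u : TangentSpace I x}
    (h : ∀ Z : (p : M) → TangentSpace I p, MDiffAt (T% Z) x →
      koszulForm g X Y Z x = g.inner x u (Z x)) :
    leviCivitaFun g Y x (X x) = u := by
  refine metric_ext g fun w => ?_
  have hw := FiberBundle.mdifferentiableAt_extend I E w
  have := inner_leviCivitaFun g hX hY hw
  rw [h _ hw] at this
  simpa using this

/-- The Levi-Civita connection of `g`; `leviCivita g Y x v` is `∇_v Y`. It is torsion free and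
metric by the two theorems that follow. -/
def leviCivita : CovariantDerivative I E (fun p : M => TangentSpace I p) where
  toFun := leviCivitaFun g
  isCovariantDerivativeOnUniv :=
    { add := by
        intro Y Y' x hY hY' _
        ext1 v
        have hv := FiberBundle.mdifferentiableAt_extend I E v
        have key := leviCivita_eq g (X := FiberBundle.extend E v) (Y := Y + Y')
          (u := leviCivitaFun g Y x v + leviCivitaFun g Y' x v) hv
          (mdifferentiableAt_add_section hY hY') (fun Z hZ => by
            have a1 := inner_leviCivitaFun g hv hY hZ
            have a2 := inner_leviCivitaFun g hv hY' hZ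
            rw [FiberBundle.extend_apply_self] at a1 a2
            rw [map_add, add_apply, a1, a2]
            have e1 (Z : (p : M) → TangentSpace I p) :
                (fun p => g.inner p ((Y + Y') p) (Z p)) =
                (fun p => g.inner p (Y p) (Z p)) + (fun p => g.inner p (Y' p) (Z p)) := by
              ext p; simp
            have e2 (X : (p : M) → TangentSpace I p) :
                (fun p => g.inner p (X p) ((Y + Y') p)) =
                (fun p => g.inner p (X p) (Y p)) + (fun p => g.inner p (X p) (Y' p)) := by
              ext p; simp
            simp only [koszulForm, e1, e2,
              mvfderiv_add (metric_mdiffAt g hY hZ) (metric_mdiffAt g hY' hZ),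
              mvfderiv_add (metric_mdiffAt g hv hY) (metric_mdiffAt g hv hY'),
              mlieBracket_add_right hY hY', mlieBracket_add_left hY hY']
            simp
            ring)
        rw [FiberBundle.extend_apply_self] at key
        exact key
      leibniz := by
        intro Y f x hY hf _
        ext1 v
        have hv := FiberBundle.mdifferentiableAt_extend I E v
        have key := leviCivita_eq g (X := FiberBundle.extend E v) (Y := f • Y)
          (u := f x • leviCivitaFun g Y x v + (d% f x v) • Y x) hv
          (hf.smul_section hY) (fun Z hZ => by
            have a1 := inner_leviCivitaFun g hv hY hZ
            rw [FiberBundle.extend_apply_self] at a1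
            have e1 (Z : (p : M) → TangentSpace I p) :
                (fun p => g.inner p ((f • Y) p) (Z p)) =
                f * (fun p => g.inner p (Y p) (Z p)) := by
              ext p; simp
            have e2 (X : (p : M) → TangentSpace I p) :
                (fun p => g.inner p (X p) ((f • Y) p)) =
                f * (fun p => g.inner p (X p) (Y p)) := by
              ext p; simp
            rw [map_add, map_smul, map_smul, add_apply,
              smul_apply, smul_apply, a1]
            simp only [koszulForm, e1, e2, mvfderiv_mul hf (metric_mdiffAt g hY hZ),
              mvfderiv_mul hf (metric_mdiffAt g hv hY),
              mlieBracket_smul_right hf hY, mlieBracket_smul_left hf hY]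
            simp [g.symm x (Y x) v]
            ring)
        rw [FiberBundle.extend_apply_self] at key
        simpa using key }

theorem leviCivita_torsion : (leviCivita g).torsion = 0 := by
  rw [CovariantDerivative.torsion_eq_zero_iff]
  intro X Y x hX hY
  refine metric_ext g fun w => ?_
  have hw := FiberBundle.mdifferentiableAt_extend I E w
  have a1 := inner_leviCivitaFun g hX hY hw
  have a2 := inner_leviCivitaFun g hY hX hw
  rw [FiberBundle.extend_apply_self] at a1 a2
  change g.inner x (leviCivitaFun g Y x (X x) - leviCivitaFun g X x (Y x)) w = _
  rw [map_sub, sub_apply, a1, a2]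
  have e : (fun p => g.inner p (Y p) (X p)) = fun p => g.inner p (X p) (Y p) := by
    ext p; exact g.symm p _ _
  simp only [koszulForm, e, mlieBracket_swap_apply (I := I) (V := Y) (W := X)]
  simp
  ring

theorem leviCivita_metric {X Y Z : (p : M) → TangentSpace I p} {x : M}
    (hX : MDiffAt (T% X) x) (hY : MDiffAt (T% Y) x) (hZ : MDiffAt (T% Z) x) :
    d% (fun p => g.inner p (Y p) (Z p)) x (X x) =
      g.inner x (leviCivita g Y x (X x)) (Z x) + g.inner x (Y x) (leviCivita g Z x (X x)) := by
  have a1 := inner_leviCivitaFun g hX hY hZ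
  have a2 := inner_leviCivitaFun g hX hZ hY
  rw [g.symm x (Y x)]
  change _ = g.inner x (leviCivitaFun g Y x (X x)) (Z x) + g.inner x (leviCivitaFun g Z x (X x)) (Y x)
  rw [a1, a2]
  have e : (fun p => g.inner p (Z p) (Y p)) = fun p => g.inner p (Y p) (Z p) := by
    ext p; exact g.symm p _ _
  simp only [koszulForm, e, mlieBracket_swap_apply (I := I) (V := Z) (W := Y)]
  simp
  ring

end LeviCivita

/-- A codimension-one foliation of an `(n+1)`-manifold: a partition into connected sets (the leaves)
such that around every point there is a smooth chart, centred at this point, in which the connected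
components of the trace of each leaf are the slices on which the last coordinate is constant. -/
structure Foliation (n : ℕ) (M : Type*) [TopologicalSpace M]
    [ChartedSpace (EuclideanSpace ℝ (Fin (n + 1))) M] where
  leaves : Set (Set M)
  isConnected : ∀ L ∈ leaves, IsConnected L
  cover : ⋃₀ leaves = univ
  disjoint : ∀ L ∈ leaves, ∀ L' ∈ leaves, L ≠ L' → Disjoint L L'
  exists_chart : ∀ q : M, ∃ e ∈ IsManifold.maximalAtlas (𝓡 (n + 1)) ∞ M,
    q ∈ e.source ∧ e q = 0 ∧
      ∀ L ∈ leaves, ∀ x ∈ e.source ∩ L,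
        connectedComponentIn (e '' (e.source ∩ L)) (e x) =
          {y | y ∈ e.target ∧ y (Fin.last n) = e x (Fin.last n)}

section Defs

variable {n : ℕ} {M : Type*} [TopologicalSpace M]
  [ChartedSpace (EuclideanSpace ℝ (Fin (n + 1))) M]

/-- `v ∈ T_q M` is tangent to the leaf through `q`: it is the velocity at time `0` of a smooth
curve that starts at `q` and stays in one leaf. -/
def Foliation.IsTangent (F : Foliation n M) (q : M) (v : TangentSpace (𝓡 (n + 1)) q) : Prop :=
  ∃ L ∈ F.leaves, ∃ γ : ℝ → M, ContMDiffAt 𝓘(ℝ, ℝ) (𝓡 (n + 1)) ∞ γ 0 ∧ (∀ᶠ s in 𝓝 0, γ s ∈ L) ∧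
    tangentMap 𝓘(ℝ, ℝ) (𝓡 (n + 1)) γ ⟨0, (1 : ℝ)⟩ = ⟨q, v⟩

/-- Vector fields on `M`. -/
abbrev VField (n : ℕ) (M : Type*) [TopologicalSpace M]
    [ChartedSpace (EuclideanSpace ℝ (Fin (n + 1))) M] : Type _ :=
  (p : M) → TangentSpace (𝓡 (n + 1)) p

variable [IsManifold (𝓡 (n + 1)) ∞ M]

/-- Smooth vector fields. -/
def IsSmoothField (X : VField n M) : Prop :=
  ContMDiff (𝓡 (n + 1)) (𝓡 (n + 1)).tangent ∞
    (fun p => (⟨p, X p⟩ : TangentBundle (𝓡 (n + 1)) M))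

/-- A transverse orientation of `F`, given by a smooth vector field nowhere tangent to `F`
(the positive side). -/
structure IsTransverseOrientation (F : Foliation n M) (ν : VField n M) : Prop where
  smooth : IsSmoothField ν
  transverse : ∀ p, ¬ F.IsTangent p (ν p)

/-- Smooth Riemannian metrics on `M`. -/
abbrev RMetric (n : ℕ) (M : Type*) [TopologicalSpace M]
    [ChartedSpace (EuclideanSpace ℝ (Fin (n + 1))) M] [IsManifold (𝓡 (n + 1)) ∞ M] : Type _ :=
  ContMDiffRiemannianMetric (𝓡 (n + 1)) ∞ (EuclideanSpace ℝ (Fin (n + 1)))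
    (fun p : M => TangentSpace (𝓡 (n + 1)) p)

/-- `N` is the `g`-unit normal vector field of `F` that is positive for the transverse
orientation `ν`. -/
structure IsUnitNormal (F : Foliation n M) (ν : VField n M) (g : RMetric n M) (N : VField n M) :
    Prop where
  smooth : IsSmoothField N
  unit : ∀ p, g.inner p (N p) (N p) = 1
  normal : ∀ p v, F.IsTangent p v → g.inner p (N p) v = 0
  pos : ∀ p, 0 < g.inner p (N p) (ν p)

/-- The component `v ↦ v - g(N, v) N` of a vector tangent to the foliation with unit normal `N`. -/
def tangentialPart (g : RMetric n M) (N : VField n M) (p : M) :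
    TangentSpace (𝓡 (n + 1)) p →L[ℝ] TangentSpace (𝓡 (n + 1)) p :=
  ContinuousLinearMap.id ℝ _ - (g.inner p (N p)).smulRight (N p)

/-- The Weingarten operator `A X = -∇_X N` for `X` tangent to the leaves, extended by `A N = 0`. -/
def weingarten (g : RMetric n M) (N : VField n M) (p : M) :
    TangentSpace (𝓡 (n + 1)) p →L[ℝ] TangentSpace (𝓡 (n + 1)) p :=
  -((leviCivita g N p).comp (tangentialPart g N p))

/-- The truncated symmetric tensor `b̂_j` dual to the `j`-th power of the Weingarten operator;
in particular `b̂_0` is the truncated metric. -/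
def bHat (g : RMetric n M) (N : VField n M) (j : ℕ) (p : M) (v w : TangentSpace (𝓡 (n + 1)) p) :
    ℝ :=
  g.inner p ((weingarten g N p ^ j) (tangentialPart g N p v)) (tangentialPart g N p w)

/-- The power sum `τ_i` of the principal curvatures: the trace of the `i`-th power of the
Weingarten operator on the tangent spaces of the leaves. (The composition with the projection onto
the tangent space of the leaf matters for `i = 0` only, where the value is `n`.) -/
def powerSum (g : RMetric n M) (N : VField n M) (i : ℕ) (p : M) : ℝ :=
  LinearMap.trace ℝ (TangentSpace (𝓡 (n + 1)) p)
    ((weingarten g N p ^ i).comp (tangentialPart g N p)).toLinearMap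

/-- `g t`, `0 ≤ t < ε`, with positive unit normals `N t`, is a (smooth) extrinsic geometric flow
with coefficient functions `f j`, `0 ≤ j < n`: `∂_t g_t = ∑_{j<n} f_j b̂_j^t`. -/
structure IsEGF (F : Foliation n M) (ν : VField n M) (f : ℕ → M → ℝ → ℝ) (ε : ℝ)
    (g : ℝ → RMetric n M) (N : ℝ → VField n M) : Prop where
  smooth : ContMDiffOn ((𝓡 (n + 1)).prod 𝓘(ℝ, ℝ))
    ((𝓡 (n + 1)).prod 𝓘(ℝ, EuclideanSpace ℝ (Fin (n + 1)) →L[ℝ]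
      EuclideanSpace ℝ (Fin (n + 1)) →L[ℝ] ℝ)) ∞
    (fun z : M × ℝ => TotalSpace.mk' (EuclideanSpace ℝ (Fin (n + 1)) →L[ℝ]
      EuclideanSpace ℝ (Fin (n + 1)) →L[ℝ] ℝ)
      (E := fun p : M => TangentSpace (𝓡 (n + 1)) p →L[ℝ] TangentSpace (𝓡 (n + 1)) p →L[ℝ] ℝ)
      z.1 ((g z.2).inner z.1))
    (univ ×ˢ Ico 0 ε)
  isUnitNormal : ∀ t ∈ Ico 0 ε, IsUnitNormal F ν (g t) (N t)
  evolution : ∀ t ∈ Ico 0 ε, ∀ (p : M) (v w : TangentSpace (𝓡 (n + 1)) p),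
    HasDerivWithinAt (fun s => (g s).inner p v w)
      (∑ j ∈ Finset.range n, f j p t * bHat (g t) (N t) j p v w) (Ico 0 ε) t

end Defs

section Flow

/-- A vector field is complete if every point lies on an integral curve defined on all of `ℝ`. -/
def IsCompleteField {E H M : Type*} [NormedAddCommGroup E] [NormedSpace ℝ E] [TopologicalSpace H]
    {I : ModelWithCorners ℝ E H} [TopologicalSpace M] [ChartedSpace H M]
    (X : (p : M) → TangentSpace I p) : Prop :=
  ∀ p : M, ∃ γ : ℝ → M, γ 0 = p ∧ IsMIntegralCurve γ X

/-- `φ` is the (global) flow of `X`: each orbit `t ↦ φ t z` is the integral curve of `X`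
starting at `z`. -/
structure IsFlow {E H M : Type*} [NormedAddCommGroup E] [NormedSpace ℝ E] [TopologicalSpace H]
    {I : ModelWithCorners ℝ E H} [TopologicalSpace M] [ChartedSpace H M]
    (X : (p : M) → TangentSpace I p) (φ : ℝ → M → M) : Prop where
  zero : ∀ z, φ 0 z = z
  orbit : ∀ z, IsMIntegralCurve (fun t => φ t z) X

variable {n : ℕ} {M : Type*} [TopologicalSpace M]
  [ChartedSpace (EuclideanSpace ℝ (Fin (n + 1))) M]

/-- The vector field `∂_t + (C/2) N` on `M × ℝ`. -/
def spaceTimeField (C : ℝ) (N : VField n M) :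
    (z : M × ℝ) → TangentSpace ((𝓡 (n + 1)).prod 𝓘(ℝ, ℝ)) z :=
  fun z => ((C / 2) • N z.1, (1 : ℝ))

end Flow

end EGF

end

/-! The field `N` does not change along the flow: `∂_t g` annihilates the normal, so the `g_t`-dual
vector of a covector defining the tangent hyperplane is constant, and length and sign fix the
multiple of it that is `N` (`unitNormal_const`). Hence the covector `g_t(N, ·)` is constant in time
too. Let `G` be the metric truncated to the leaves and `B = g(A ·, ·)` the second fundamental form.
Then `∂_t G = C B`, while the Koszul formula gives `B = -½ L_N G`. So `(∂_t + (C/2) L_N) G = 0`. As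
`N` is independent of time, `L_N` commutes with `∂_t`, and `B = -½ L_N G` satisfies the same
equation (`hasDerivAt_of_lieTransport`).

Thus `G` and `B` are both Lie transported along `∂_t + (C/2) N`. Since `G A = B` and the kernel of
`G` is spanned by `N`, the operator `A` is transported up to a term `η ⊗ N` with `η(N) = 0`. Its
derivative is therefore a commutator plus such a term, and neither affects the traces of the
positive powers (`hasDerivAt_trace_pow_of_transport`). Hence `τ_i` is constant on the integral
curves, for `i ≥ 1`; for `i = 0` it is the constant `n`.

All differentiation is done in coordinates, for an abstract flow on an open set of a vector space
(`IsLocalFlow`). The symmetry of `A` is not derived from the integrability of the leaves: it follows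
from the symmetry of `∂_t g = C g(A ·, ·)` after division by `C`. The case `C = 0`, where nothing
moves, is therefore treated separately in `IsSecondFormFlow.powerSum_eq`. -/

noncomputable section

namespace EGF

open Bundle Set Filter Topology VectorField

/-! ### Linear algebra: traces of powers of a transported endomorphism -/

section Transport

variable {E : Type*} [NormedAddCommGroup E] [NormedSpace ℝ E]

/-- If `A' = [K, A] + η ⊗ n` with `A n = 0` and `η n = 0`, then the positive powers of `A` evolve
in the same way. -/
theorem hasDerivAt_pow_of_commutator {A : ℝ → E →L[ℝ] E} {K : E →L[ℝ] E} {η : E →L[ℝ] ℝ} {n : E}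
    {s : ℝ} (hA : HasDerivAt A (K * A s - A s * K + η.smulRight n) s) (hn : A s n = 0)
    (hη : η n = 0) (i : ℕ) :
    ∃ ξ : E →L[ℝ] ℝ, ξ n = 0 ∧
      HasDerivAt (fun r => A r ^ (i + 1))
        (K * A s ^ (i + 1) - A s ^ (i + 1) * K + ξ.smulRight n) s := by
  induction i with
  | zero => exact ⟨η, hη, by simpa using hA⟩
  | succ i ih =>
    obtain ⟨ξ, -, h⟩ := ih
    -- In the Leibniz rule `A ^ (i + 1)` kills the correction `η ⊗ n` since `A n = 0`, and `(ξ ⊗ n)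
    -- A = (ξ ∘ A) ⊗ n`. The new covector vanishes on `n` again because `A n = 0`.
    refine ⟨ξ.comp (A s), by simp [hn], ?_⟩
    have h2 : HasDerivAt (fun r => A r ^ (i + 1 + 1)) _ s :=
      (h.mul hA).congr_of_eventuallyEq (.of_forall fun r => pow_succ _ _)
    convert! h2 using 1
    have e1 : A s ^ (i + 1) * η.smulRight n = 0 := by
      ext u; simp [pow_succ, hn]
    have e2 : ξ.smulRight n * A s = (ξ.comp (A s)).smulRight n := by
      ext u; simp
    rw [add_mul, mul_add, e1, e2, pow_succ]
    noncomm_ring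

variable [FiniteDimensional ℝ E]

/-- The trace of a continuous endomorphism, as a continuous linear functional. -/
def traceCLM (E : Type*) [NormedAddCommGroup E] [NormedSpace ℝ E] [FiniteDimensional ℝ E] :
    (E →L[ℝ] E) →L[ℝ] ℝ :=
  LinearMap.toContinuousLinearMap
    ((LinearMap.trace ℝ E).comp (ContinuousLinearMap.coeLM ℝ))

theorem traceCLM_apply (T : E →L[ℝ] E) : traceCLM E T = LinearMap.trace ℝ E T.toLinearMap := rfl

theorem traceCLM_smulRight (η : E →L[ℝ] ℝ) (n : E) : traceCLM E (η.smulRight n) = η n := by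
  rw [traceCLM_apply]
  exact LinearMap.trace_smulRight η.toLinearMap n

theorem traceCLM_mul_comm (S T : E →L[ℝ] E) : traceCLM E (S * T) = traceCLM E (T * S) := by
  rw [traceCLM_apply, traceCLM_apply]
  exact LinearMap.trace_mul_comm ℝ S.toLinearMap T.toLinearMap

/-- A commutator has trace zero, and the trace of `ξ ⊗ n` is `ξ n = 0`. -/
theorem hasDerivAt_trace_pow_of_commutator {A : ℝ → E →L[ℝ] E} {K : E →L[ℝ] E} {η : E →L[ℝ] ℝ}
    {n : E} {s : ℝ} (hA : HasDerivAt A (K * A s - A s * K + η.smulRight n) s) (hn : A s n = 0)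
    (hη : η n = 0) (i : ℕ) : HasDerivAt (fun r => traceCLM E (A r ^ (i + 1))) 0 s := by
  obtain ⟨ξ, hξ, h⟩ := hasDerivAt_pow_of_commutator hA hn hη i
  have h2 := (traceCLM E).hasFDerivAt.comp_hasDerivAt s h
  convert! h2 using 1
  rw [map_add, map_sub, traceCLM_mul_comm K, sub_self, traceCLM_smulRight, hξ, add_zero]

/-- Let `G`, `B` be bilinear forms along a curve, with `G' = -(G K + Kᵗ G)`, `B' = -(B K + Kᵗ B)`,
where the kernel of `G` is spanned by a vector `n` with `n' = K n`. If `G A = B` and `A n = 0`, then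
the traces of the powers of `A` are constant. -/
theorem hasDerivAt_trace_pow_of_transport {G B : ℝ → E →L[ℝ] E →L[ℝ] ℝ} {A : ℝ → E →L[ℝ] E}
    {n : ℝ → E} {G' B' : E →L[ℝ] E →L[ℝ] ℝ} {A' K : E →L[ℝ] E} {θ : E →L[ℝ] ℝ} {s : ℝ}
    (hG : HasDerivAt G G' s) (hB : HasDerivAt B B' s) (hA : HasDerivAt A A' s)
    (hn : HasDerivAt n (K (n s)) s)
    (hG' : ∀ u v, G' u v = -(G s (K u) v + G s u (K v)))
    (hB' : ∀ u v, B' u v = -(B s (K u) v + B s u (K v)))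
    (hGA : ∀ᶠ r in 𝓝 s, ∀ u v, G r (A r u) v = B r u v)
    (hAn : ∀ᶠ r in 𝓝 s, A r (n r) = 0)
    (hker : ∀ w, (∀ v, G s w v = 0) → ∃ c : ℝ, w = c • n s) (hθ : θ (n s) = 1) (i : ℕ) :
    HasDerivAt (fun r => traceCLM E (A r ^ (i + 1))) 0 s := by
  have hGA0 := hGA.self_of_nhds
  have hAn0 := hAn.self_of_nhds
  -- Differentiating `G A = B` and inserting the transport equations, the terms with `K` in the
  -- second slot cancel, which leaves `G A' = G [K, A]`.
  have key (u v : E) : G s (A' u) v = G s ((K * A s - A s * K) u) v := by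
    have h1 : HasDerivAt (fun r => G r (A r u) v) (G' (A s u) v + G s (A' u) v) s := by
      have := (hG.clm_apply (hA.clm_apply (hasDerivAt_const s u))).clm_apply (hasDerivAt_const s v)
      simpa using this
    have h2 : HasDerivAt (fun r => G r (A r u) v) (B' u v) s := by
      have := (hB.clm_apply (hasDerivAt_const s u)).clm_apply (hasDerivAt_const s v)
      refine HasDerivAt.congr_of_eventuallyEq (by simpa using this) ?_
      filter_upwards [hGA] with r hr using hr u v
    have h3 := h1.unique h2
    rw [hG', hB', ← hGA0 u (K v), ← hGA0 (K u) v] at h3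
    simp only [sub_apply, mul_apply_eq_comp, map_sub] at h3 ⊢
    linarith
  -- The defect `A' - [K, A]` takes values in the kernel of `G`, the line of `n`; the covector `θ`
  -- reads off the coefficient.
  have hη (u : E) : A' u - (K * A s - A s * K) u = θ (A' u - (K * A s - A s * K) u) • n s := by
    obtain ⟨c, hc⟩ := hker (A' u - (K * A s - A s * K) u) fun v => by
      rw [map_sub, sub_apply, key, sub_self]
    rw [hc, map_smul, hθ, smul_eq_mul, mul_one]
  set η : E →L[ℝ] ℝ := θ.comp (A' - (K * A s - A s * K)) with hηdef
  have hA'eq : A' = K * A s - A s * K + η.smulRight (n s) := by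
    ext1 u
    have := hη u
    rw [sub_eq_iff_eq_add] at this
    rw [this]
    simp [hηdef, add_comm]
  -- Differentiating `A n = 0` with `n' = K n` gives `A' n = -A K n`, which is `[K, A] n`.
  have hηn : η (n s) = 0 := by
    have h1 : HasDerivAt (fun r => A r (n r)) (A' (n s) + A s (K (n s))) s := hA.clm_apply hn
    have h2 : HasDerivAt (fun r => A r (n r)) 0 s :=
      (hasDerivAt_const s (0 : E)).congr_of_eventuallyEq
        (by filter_upwards [hAn] with r hr using hr)
    have h3 := h1.unique h2
    have : A' (n s) - (K * A s - A s * K) (n s) = 0 := by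
      simp only [sub_apply, mul_apply_eq_comp, hAn0, map_zero, zero_sub, sub_neg_eq_add]
      exact h3
    simp only [hηdef, ContinuousLinearMap.comp_apply]
    rw [sub_apply, this, map_zero]
  rw [hA'eq] at hA
  exact hasDerivAt_trace_pow_of_commutator hA hAn0 hηn i

end Transport

/-! ### Lie transport of the truncated metric and the second fundamental form -/

section LieTransport

variable {E F : Type*} [NormedAddCommGroup E] [NormedSpace ℝ E] [NormedAddCommGroup F]
  [NormedSpace ℝ F]

/-- Let `L_N = ∂_N + R` act on functions with values in `F`, where `R` is of order zero and
independent of time. If `∂_t G = C B` and `B = -½ L_N G` on an open set of space-time, then both `G`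
and `B` are Lie transported along the integral curves of `∂_t + (C/2) N`. -/
theorem hasDerivAt_of_lieTransport {Ω : Set (E × ℝ)} (hΩ : IsOpen Ω)
    {G B : E × ℝ → F} {N : E → E} {R : E → F →L[ℝ] F} {C : ℝ}
    (hG : ContDiffOn ℝ 2 G Ω) (hB : DifferentiableOn ℝ B Ω)
    (hspace : ∀ z ∈ Ω, B z = -(1 / 2 : ℝ) • (fderiv ℝ G z (N z.1, 0) + R z.1 (G z)))
    (htime : ∀ z ∈ Ω, fderiv ℝ G z (0, 1) = C • B z)
    {z : ℝ → E × ℝ} {s : ℝ} (hz : HasDerivAt z ((C / 2) • N (z s).1, 1) s) (hzs : z s ∈ Ω) :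
    HasDerivAt (fun r => G (z r)) (-(C / 2) • R (z s).1 (G (z s))) s ∧
      HasDerivAt (fun r => B (z r)) (-(C / 2) • R (z s).1 (B (z s))) s := by
  have hnhds := hΩ.mem_nhds hzs
  obtain ⟨p, hp⟩ : ∃ p, p = z s := ⟨_, rfl⟩
  rw [← hp] at hzs hnhds hz ⊢
  have hGp : ContDiffAt ℝ 2 G p := hG.contDiffAt hnhds
  have hGd : DifferentiableAt ℝ G p := hGp.differentiableAt (by simp)
  have hBd : DifferentiableAt ℝ B p := hB.differentiableAt hnhds
  have hsplit : (((C / 2) • N p.1, 1) : E × ℝ) = (C / 2) • (N p.1, 0) + (0, 1) := by simp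
  constructor
  · convert! hGd.hasFDerivAt.comp_hasDerivAt_of_eq s hz hp using 1
    rw [hsplit, map_add, map_smul, htime p hzs, hspace p hzs]
    module
  · convert! hBd.hasFDerivAt.comp_hasDerivAt_of_eq s hz hp using 1
    have hdG : DifferentiableAt ℝ (fderiv ℝ G) p :=
      (hGp.fderiv_right (m := 1) (by norm_num)).differentiableAt (by simp)
    have hsymm := hGp.isSymmSndFDerivAt (by simp) (N p.1, 0) (0, 1)
    have hline (w : E × ℝ) : HasDerivAt (fun r : ℝ => p + r • w) w 0 := by
      simpa using ((hasDerivAt_id (0 : ℝ)).smul_const w).const_add p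
    have hp0 (w : E × ℝ) : p = p + (0 : ℝ) • w := by simp
    have hev (w : E × ℝ) : ∀ᶠ r : ℝ in 𝓝 0, p + r • w ∈ Ω := by
      have hc : ContinuousAt (fun r : ℝ => p + r • w) 0 := (hline w).continuousAt
      exact hc.eventually_mem (by simpa using hnhds)
    -- This is `∂_t G = C B` differentiated along `N`. The symmetry of the second derivative then
    -- yields the time derivative of `∂_N G`.
    have hmix : fderiv ℝ (fderiv ℝ G) p (N p.1, 0) (0, 1) = C • fderiv ℝ B p (N p.1, 0) := by
      have h1 : HasDerivAt (fun r : ℝ => fderiv ℝ G (p + r • (N p.1, (0 : ℝ))) (0, 1))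
          (fderiv ℝ (fderiv ℝ G) p (N p.1, 0) (0, 1)) 0 := by
        simpa using (hdG.hasFDerivAt.comp_hasDerivAt_of_eq (0 : ℝ) (hline (N p.1, 0))
          (hp0 _)).clm_apply (hasDerivAt_const (0 : ℝ) ((0, 1) : E × ℝ))
      have h2 : HasDerivAt (fun r : ℝ => fderiv ℝ G (p + r • (N p.1, (0 : ℝ))) (0, 1))
          (C • fderiv ℝ B p (N p.1, 0)) 0 := by
        refine ((hBd.hasFDerivAt.comp_hasDerivAt_of_eq (0 : ℝ) (hline (N p.1, 0))
          (hp0 _)).const_smul C).congr_of_eventuallyEq ?_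
        filter_upwards [hev (N p.1, 0)] with r hr using htime _ hr
      exact h1.unique h2
    -- This is `B = -½ L_N G` differentiated in time: `N` and `R` depend on the space variable only,
    -- so they are fixed along the vertical line, and the result is `∂_t B = -(C/2) L_N B`.
    have htB : fderiv ℝ B p (0, 1) =
        -(1 / 2 : ℝ) • (C • fderiv ℝ B p (N p.1, 0) + C • R p.1 (B p)) := by
      have h1 : HasDerivAt (fun r : ℝ => B (p + r • (0, (1 : ℝ)))) (fderiv ℝ B p (0, 1)) 0 :=
        hBd.hasFDerivAt.comp_hasDerivAt_of_eq (0 : ℝ) (hline (0, 1)) (hp0 _)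
      have hGt : HasDerivAt (fun r : ℝ => R p.1 (G (p + r • (0, (1 : ℝ)))))
          (C • R p.1 (B p)) 0 := by
        have h0 := (R p.1).hasFDerivAt.comp_hasDerivAt (0 : ℝ)
          (hGd.hasFDerivAt.comp_hasDerivAt_of_eq (0 : ℝ) (hline (0, 1)) (hp0 _))
        rw [htime p hzs, map_smul] at h0
        exact h0
      have hDG : HasDerivAt (fun r : ℝ => fderiv ℝ G (p + r • (0, (1 : ℝ))) (N p.1, 0))
          (C • fderiv ℝ B p (N p.1, 0)) 0 := by
        rw [← hmix, hsymm]
        simpa using (hdG.hasFDerivAt.comp_hasDerivAt_of_eq (0 : ℝ) (hline (0, 1))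
          (hp0 _)).clm_apply (hasDerivAt_const (0 : ℝ) ((N p.1, 0) : E × ℝ))
      refine h1.unique (((hDG.add hGt).const_smul (-(1 / 2) : ℝ)).congr_of_eventuallyEq ?_)
      filter_upwards [hev (0, 1)] with r hr
      have := hspace _ hr
      simp only [Prod.fst_add, Prod.smul_fst, smul_zero, add_zero] at this
      exact this
    rw [hsplit, map_add, map_smul, htB]
    module

end LieTransport

/-! ### The second fundamental form as a Lie derivative of the truncated metric -/

section Truncated

variable {E : Type*} [NormedAddCommGroup E] [NormedSpace ℝ E]

instance instNormedAddCommGroupLinearForm : NormedAddCommGroup (E →L[ℝ] ℝ) :=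
  ContinuousLinearMap.toNormedAddCommGroup

instance instNormedSpaceLinearForm : NormedSpace ℝ (E →L[ℝ] ℝ) :=
  ContinuousLinearMap.toNormedSpace

instance instNormedAddCommGroupBilinForm : NormedAddCommGroup (E →L[ℝ] E →L[ℝ] ℝ) :=
  ContinuousLinearMap.toNormedAddCommGroup

instance instNormedSpaceBilinForm : NormedSpace ℝ (E →L[ℝ] E →L[ℝ] ℝ) :=
  ContinuousLinearMap.toNormedSpace

/-- The action `β ↦ β(D ·, ·) + β(·, D ·)` of an endomorphism `D` on bilinear forms. -/
def bilinAction (D : E →L[ℝ] E) : (E →L[ℝ] E →L[ℝ] ℝ) →L[ℝ] (E →L[ℝ] E →L[ℝ] ℝ) :=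
  (ContinuousLinearMap.compL ℝ E E (E →L[ℝ] ℝ)).flip D
    + ContinuousLinearMap.compL ℝ E (E →L[ℝ] ℝ) (E →L[ℝ] ℝ)
        ((ContinuousLinearMap.compL ℝ E E ℝ).flip D)

theorem bilinAction_apply (D : E →L[ℝ] E) (β : E →L[ℝ] E →L[ℝ] ℝ) (u v : E) :
    bilinAction D β u v = β (D u) v + β u (D v) := by
  simp [bilinAction]

/-- The bilinear form `β - β(n, ·) ⊗ β(n, ·)`; for a symmetric `β` with `β(n, n) = 1` it is the
restriction of `β` to the orthogonal complement of `n`, extended by `0`. -/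
def truncate (β : E →L[ℝ] E →L[ℝ] ℝ) (n : E) : E →L[ℝ] E →L[ℝ] ℝ :=
  β - (β n).smulRight (β n)

theorem truncate_apply (β : E →L[ℝ] E →L[ℝ] ℝ) (n u v : E) :
    truncate β n u v = β u v - β n u * β n v := by
  simp [truncate]

/-- Both sides are symmetric forms that annihilate `N`, so it suffices to compare them on the
orthogonal complement of `N`. There the truncation is invisible to first order, and the Koszul
identity applies. -/
theorem eq_lieDerivative_truncate {g : E → E →L[ℝ] E →L[ℝ] ℝ} {N : E → E} {x : E}
    {b : E →L[ℝ] E →L[ℝ] ℝ} (hg : DifferentiableAt ℝ g x) (hN : DifferentiableAt ℝ N x)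
    (hsymm : ∀ᶠ y in 𝓝 x, ∀ u v, g y u v = g y v u) (hunit : ∀ᶠ y in 𝓝 x, g y (N y) (N y) = 1)
    (hbN : ∀ v, b (N x) v = 0) (hb : ∀ u v, b u v = b v u)
    (hkos : ∀ u v, g x (N x) u = 0 → g x (N x) v = 0 →
      2 * b u v = -(fderiv ℝ g x (N x) u v + g x (fderiv ℝ N x u) v + g x u (fderiv ℝ N x v))) :
    b = -(1 / 2 : ℝ) • (fderiv ℝ (fun y => truncate (g y) (N y)) x (N x)
      + bilinAction (fderiv ℝ N x) (truncate (g x) (N x))) := by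
  set D := fderiv ℝ N x with hD
  obtain ⟨T, hT⟩ : ∃ T, T = -(1 / 2 : ℝ) • (fderiv ℝ (fun y => truncate (g y) (N y)) x (N x)
      + bilinAction D (truncate (g x) (N x))) := ⟨_, rfl⟩
  have hθ : DifferentiableAt ℝ (fun y => g y (N y)) x := hg.clm_apply hN
  have hline : HasDerivAt (fun r : ℝ => x + r • N x) (N x) 0 := by
    simpa using ((hasDerivAt_id (0 : ℝ)).smul_const (N x)).const_add x
  have hx0 : x = x + (0 : ℝ) • N x := by simp
  have hGd : DifferentiableAt ℝ (fun y => truncate (g y) (N y)) x := by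
    unfold truncate
    fun_prop
  have hsymm0 := hsymm.self_of_nhds
  have hunit0 := hunit.self_of_nhds
  have hGdir (u v : E) : HasDerivAt (fun r : ℝ => truncate (g (x + r • N x)) (N (x + r • N x)) u v)
      (fderiv ℝ (fun y => truncate (g y) (N y)) x (N x) u v) 0 := by
    simpa using ((hGd.hasFDerivAt.comp_hasDerivAt_of_eq (0 : ℝ) hline hx0).clm_apply
      (hasDerivAt_const (0 : ℝ) u)).clm_apply (hasDerivAt_const (0 : ℝ) v)
  have hgdir (u v : E) : HasDerivAt (fun r : ℝ => g (x + r • N x) u v)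
      (fderiv ℝ g x (N x) u v) 0 := by
    simpa using ((hg.hasFDerivAt.comp_hasDerivAt_of_eq (0 : ℝ) hline hx0).clm_apply
      (hasDerivAt_const (0 : ℝ) u)).clm_apply (hasDerivAt_const (0 : ℝ) v)
  have hθdir (u : E) : HasDerivAt (fun r : ℝ => g (x + r • N x) (N (x + r • N x)) u)
      (fderiv ℝ (fun y => g y (N y)) x (N x) u) 0 := by
    simpa using (hθ.hasFDerivAt.comp_hasDerivAt_of_eq (0 : ℝ) hline hx0).clm_apply
      (hasDerivAt_const (0 : ℝ) u)
  -- The subtracted product `g(N, u) g(N, v)` has two factors vanishing at `x`, so its derivative is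
  -- zero.
  have hGformula (u v : E) (hu : g x (N x) u = 0) (hv : g x (N x) v = 0) :
      fderiv ℝ (fun y => truncate (g y) (N y)) x (N x) u v = fderiv ℝ g x (N x) u v := by
    have h2 := (hgdir u v).sub ((hθdir u).mul (hθdir v))
    refine ((hGdir u v).unique (h2.congr_of_eventuallyEq ?_)).trans (by simp [hu, hv])
    filter_upwards with r
    simp [truncate_apply]
  -- Since `L_N N = 0`, the form `(L_N G)(N, ·)` is the Lie derivative of `G(N, ·)`, which vanishes
  -- identically near `x`.
  have hTN (v : E) : T (N x) v = 0 := by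
    have h1 : HasDerivAt
        (fun r : ℝ => truncate (g (x + r • N x)) (N (x + r • N x)) (N (x + r • N x)) v)
        (fderiv ℝ (fun y => truncate (g y) (N y)) x (N x) (N x) v
          + truncate (g x) (N x) (D (N x)) v) 0 := by
      simpa using ((hGd.hasFDerivAt.comp_hasDerivAt_of_eq (0 : ℝ) hline hx0).clm_apply
        (hN.hasFDerivAt.comp_hasDerivAt_of_eq (0 : ℝ) hline hx0)).clm_apply
        (hasDerivAt_const (0 : ℝ) v)
    have h2 := h1.unique ((hasDerivAt_const (0 : ℝ) (0 : ℝ)).congr_of_eventuallyEq (by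
      have hc : ContinuousAt (fun r : ℝ => x + r • N x) 0 := hline.continuousAt
      have := hc.eventually (p := fun y => g y (N y) (N y) = 1) (by simpa using hunit)
      filter_upwards [this] with r hr
      simp [truncate_apply, hr]))
    have h3 : truncate (g x) (N x) (N x) (D v) = 0 := by simp [truncate_apply, hunit0]
    rw [hT]
    simp only [smul_apply, add_apply, bilinAction_apply, h3, add_zero, h2, smul_zero]
  have hTsymm (u v : E) : T u v = T v u := by
    have h1 : fderiv ℝ (fun y => truncate (g y) (N y)) x (N x) u v
        = fderiv ℝ (fun y => truncate (g y) (N y)) x (N x) v u := by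
      refine (hGdir u v).unique ((hGdir v u).congr_of_eventuallyEq ?_)
      have hc : ContinuousAt (fun r : ℝ => x + r • N x) 0 := hline.continuousAt
      have := hc.eventually (p := fun y => ∀ u v, g y u v = g y v u) (by simpa using hsymm)
      filter_upwards [this] with r hr
      rw [truncate_apply, truncate_apply, hr u v, mul_comm]
    rw [hT]
    simp only [smul_apply, add_apply, bilinAction_apply, h1, truncate_apply,
      hsymm0 (D v) u, hsymm0 (D u) v]
    congr 1
    ring
  have hTker (u v : E) (hu : g x (N x) u = 0) (hv : g x (N x) v = 0) : b u v = T u v := by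
    have := hkos u v hu hv
    rw [hT]
    simp only [smul_apply, add_apply, bilinAction_apply, hGformula u v hu hv, truncate_apply, hu,
      hv, smul_eq_mul]
    linarith
  rw [← hT]
  ext u v
  -- Each vector is its orthogonal part plus a multiple of `N`, and the latter contributes nothing
  -- on either side.
  have hz (u : E) : g x (N x) (u - g x (N x) u • N x) = 0 := by simp [hunit0]
  have key := hTker _ _ (hz u) (hz v)
  have hbN' (v : E) : b v (N x) = 0 := (hb _ _).trans (hbN v)
  have hTN' (v : E) : T v (N x) = 0 := (hTsymm _ _).trans (hTN v)
  simpa [hbN, hTN, hbN', hTN'] using key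

end Truncated

/-! ### The flow on an open set of a vector space -/

section LocalFlow

variable {E : Type*} [NormedAddCommGroup E] [NormedSpace ℝ E]

/-- A flow `∂_t g = C g(A ·, ·)` on an open set of a vector space, with unit normal `N`, where `A`
is the Weingarten operator: on vectors orthogonal to `N`, the symmetric part of `-2 g(A ·, ·)` is the
Lie derivative of `g` along `N`. -/
structure IsLocalFlow (U : Set E) (ε C : ℝ) (g : E × ℝ → E →L[ℝ] E →L[ℝ] ℝ) (N : E → E)
    (A : E × ℝ → E →L[ℝ] E) : Prop where
  isOpen : IsOpen U
  contDiffOn_metric : ContDiffOn ℝ ∞ g (U ×ˢ Ico 0 ε)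
  contDiffOn_normal : ContDiffOn ℝ ∞ N U
  symm : ∀ z ∈ U ×ˢ Ico 0 ε, ∀ u v, g z u v = g z v u
  pos : ∀ z ∈ U ×ˢ Ico 0 ε, ∀ u ≠ 0, 0 < g z u u
  unit : ∀ z ∈ U ×ˢ Ico 0 ε, g z (N z.1) (N z.1) = 1
  normal_const : ∀ z ∈ U ×ˢ Ico 0 ε, g z (N z.1) = g (z.1, 0) (N z.1)
  evolution : ∀ z ∈ U ×ˢ Ico 0 ε, ∀ u v,
    HasDerivWithinAt (fun s => g (z.1, s) u v) (C * g z (A z u) v) (Ico 0 ε) z.2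
  apply_normal : ∀ z ∈ U ×ˢ Ico 0 ε, A z (N z.1) = 0
  koszul : ∀ z ∈ U ×ˢ Ico 0 ε, ∀ u v, g z (N z.1) u = 0 → g z (N z.1) v = 0 →
    g z (A z u) v + g z (A z v) u = -(fderiv ℝ (fun y => g (y, z.2)) z.1 (N z.1) u v
      + g z (fderiv ℝ N z.1 u) v + g z u (fderiv ℝ N z.1 v))

/-- The space factor is open, so spatial derivatives are two-sided even at the boundary time `0`,
where space-time derivatives exist only within the domain. -/
theorem fderivWithin_prod_fst {F : Type*} [NormedAddCommGroup F] [NormedSpace ℝ F] {U : Set E}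
    {S : Set ℝ} (hU : IsOpen U) {f : E × ℝ → F} {z : E × ℝ} (hz : z ∈ U ×ˢ S)
    (hf : DifferentiableWithinAt ℝ f (U ×ˢ S) z) :
    HasFDerivAt (fun y => f (y, z.2))
      ((fderivWithin ℝ f (U ×ˢ S) z).comp (ContinuousLinearMap.inl ℝ E ℝ)) z.1 := by
  have h1 : HasFDerivWithinAt (fun y : E => (y, z.2)) (ContinuousLinearMap.inl ℝ E ℝ) U z.1 :=
    (hasFDerivAt_prodMk_left z.1 z.2).hasFDerivWithinAt
  have h2 : HasFDerivWithinAt f (fderivWithin ℝ f (U ×ˢ S) z) (U ×ˢ S) (z.1, z.2) :=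
    hf.hasFDerivWithinAt
  have hmaps : MapsTo (fun y : E => (y, z.2)) U (U ×ˢ S) := fun y hy => ⟨hy, hz.2⟩
  exact (h2.comp z.1 h1 hmaps).hasFDerivAt (hU.mem_nhds hz.1)

/-- A positive definite bilinear form on a finite-dimensional space is nondegenerate. -/
theorem isInvertible_of_pos [FiniteDimensional ℝ E] {β : E →L[ℝ] E →L[ℝ] ℝ}
    (h : ∀ u ≠ 0, 0 < β u u) : β.IsInvertible := by
  have hinj : Function.Injective β.toLinearMap := by
    rw [injective_iff_map_eq_zero]
    intro v hv
    by_contra hne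
    have h1 := h v hne
    have h2 : β v v = 0 := congrArg (fun L : E →L[ℝ] ℝ => L v) hv
    linarith
  have hdim : Module.finrank ℝ E = Module.finrank ℝ (E →L[ℝ] ℝ) := by
    rw [← (LinearMap.toContinuousLinearMap (𝕜 := ℝ) (E := E) (F' := ℝ)).finrank_eq]
    exact (Subspace.dual_finrank_eq (K := ℝ) (V := E)).symm
  refine ⟨(LinearEquiv.ofInjectiveOfFinrankEq β.toLinearMap hinj hdim).toContinuousLinearEquiv, ?_⟩
  ext u v
  rfl

namespace IsLocalFlow

variable {U : Set E} {ε C : ℝ} {g : E × ℝ → E →L[ℝ] E →L[ℝ] ℝ} {N : E → E} {A : E × ℝ → E →L[ℝ] E}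

theorem uniqueDiffOn (h : IsLocalFlow U ε C g N A) : UniqueDiffOn ℝ (U ×ˢ Ico 0 ε) :=
  h.isOpen.uniqueDiffOn.prod (uniqueDiffOn_Ico 0 ε)

theorem contDiffOn_normal_comp (h : IsLocalFlow U ε C g N A) :
    ContDiffOn ℝ ∞ (fun z : E × ℝ => N z.1) (U ×ˢ Ico 0 ε) :=
  h.contDiffOn_normal.comp contDiffOn_fst fun _ hz => hz.1

theorem contDiffOn_truncate (h : IsLocalFlow U ε C g N A) :
    ContDiffOn ℝ ∞ (fun z => truncate (g z) (N z.1)) (U ×ˢ Ico 0 ε) := by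
  have h1 := h.contDiffOn_metric
  have h2 := h1.clm_apply h.contDiffOn_normal_comp
  unfold truncate
  exact h1.sub (h2.smulRight h2)

/-- The time derivative of a symmetric form is symmetric, and this derivative is `C g(A ·, ·)`; here
`C ≠ 0` is essential. -/
theorem symm_weingarten (h : IsLocalFlow U ε C g N A) (hC : C ≠ 0) {z : E × ℝ}
    (hz : z ∈ U ×ˢ Ico 0 ε) (u v : E) :
    g z (A z u) v = g z (A z v) u := by
  have h1 := h.evolution z hz u v
  have h2 := (h.evolution z hz v u).congr (fun s hs => h.symm (z.1, s) ⟨hz.1, hs⟩ u v)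
    (h.symm (z.1, z.2) hz u v)
  exact mul_left_cancel₀ hC (UniqueDiffWithinAt.eq_deriv _ (uniqueDiffOn_Ico 0 ε _ hz.2) h1 h2)

theorem eq_lieDerivative (h : IsLocalFlow U ε C g N A) (hC : C ≠ 0) {z : E × ℝ}
    (hz : z ∈ U ×ˢ Ico 0 ε) :
    (g z).comp (A z) = -(1 / 2 : ℝ) •
      (fderivWithin ℝ (fun z => truncate (g z) (N z.1)) (U ×ˢ Ico 0 ε) z (N z.1, 0)
        + bilinAction (fderiv ℝ N z.1) (truncate (g z) (N z.1))) := by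
  have hU := h.isOpen.mem_nhds hz.1
  have hgd : DifferentiableAt ℝ (fun y => g (y, z.2)) z.1 := (fderivWithin_prod_fst h.isOpen hz
    (h.contDiffOn_metric.differentiableOn (by simp) z hz)).differentiableAt
  have hNd : DifferentiableAt ℝ N z.1 :=
    (h.contDiffOn_normal.contDiffAt hU).differentiableAt (by simp)
  have h1 := eq_lieDerivative_truncate (g := fun y => g (y, z.2)) (N := N) (x := z.1)
    (b := (g z).comp (A z)) hgd hNd
    (by filter_upwards [hU] with y hy using h.symm (y, z.2) ⟨hy, hz.2⟩)
    (by filter_upwards [hU] with y hy using h.unit (y, z.2) ⟨hy, hz.2⟩)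
    (fun v => by simp [h.apply_normal z hz])
    (fun u v => h.symm_weingarten hC hz u v)
    (fun u v hu hv => by
      have := h.koszul z hz u v hu hv
      rw [h.symm_weingarten hC hz v u] at this
      simp only [ContinuousLinearMap.comp_apply]
      rw [two_mul, this])
  have h2 := fderivWithin_prod_fst h.isOpen hz
    (h.contDiffOn_truncate.differentiableOn (by simp) z hz)
  rw [h2.fderiv] at h1
  exact h1

/-- No regularity of `A` is assumed in `IsLocalFlow`; it is read off from the Lie derivative
formula, whose ingredients are smooth. Inverting the metric then gives the smoothness of `A` itself.
-/
theorem contDiffOn_secondForm (h : IsLocalFlow U ε C g N A) (hC : C ≠ 0) :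
    ContDiffOn ℝ ∞ (fun z => (g z).comp (A z)) (U ×ˢ Ico 0 ε) := by
  have h1 : ContDiffOn ℝ ∞ (fun z : E × ℝ => fderiv ℝ N z.1) (U ×ˢ Ico 0 ε) :=
    (h.contDiffOn_normal.fderiv_of_isOpen h.isOpen (by simp)).comp contDiffOn_fst fun _ hz => hz.1
  have h2 : ContDiffOn ℝ ∞ (fun z : E × ℝ => (N z.1, (0 : ℝ))) (U ×ˢ Ico 0 ε) :=
    h.contDiffOn_normal_comp.prodMk contDiffOn_const
  have h3 := (h.contDiffOn_truncate.fderivWithin h.uniqueDiffOn (m := ∞) (by simp)).clm_apply h2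
  have h4 : ContDiffOn ℝ ∞ (fun z => bilinAction (fderiv ℝ N z.1) (truncate (g z) (N z.1)))
      (U ×ˢ Ico 0 ε) := by
    refine ContDiffOn.clm_apply ?_ h.contDiffOn_truncate
    unfold bilinAction
    exact (contDiffOn_const.clm_apply h1).add
      (contDiffOn_const.clm_apply (contDiffOn_const.clm_apply h1))
  exact ((h3.add h4).const_smul (-(1 / 2) : ℝ)).congr fun z hz => h.eq_lieDerivative hC hz

theorem contDiffOn_weingarten [FiniteDimensional ℝ E] (h : IsLocalFlow U ε C g N A) (hC : C ≠ 0) :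
    ContDiffOn ℝ ∞ A (U ×ˢ Ico 0 ε) := by
  have h1 : ContDiffOn ℝ ∞ (fun z => (g z).inverse.comp ((g z).comp (A z))) (U ×ˢ Ico 0 ε) := by
    refine ContDiffOn.clm_comp (fun z hz => ?_) (h.contDiffOn_secondForm hC)
    have := FiniteDimensional.complete ℝ E
    obtain ⟨e, he⟩ := isInvertible_of_pos (h.pos z hz)
    have h2 : ContDiffAt ℝ ∞ ContinuousLinearMap.inverse (g z) := he ▸ contDiffAt_map_inverse e
    exact h2.comp_contDiffWithinAt z (h.contDiffOn_metric z hz)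
  refine h1.congr fun z hz => ?_
  obtain ⟨e, he⟩ := isInvertible_of_pos (h.pos z hz)
  ext1 u
  simp [← he]

/-- The covector `g(N, ·)` is constant in time, so `G` and `g` have the same time derivative. Only
interior times occur, where the derivative is two-sided. -/
theorem fderiv_time (h : IsLocalFlow U ε C g N A) {z : E × ℝ} (hz : z ∈ U ×ˢ Ioo 0 ε) :
    fderiv ℝ (fun z => truncate (g z) (N z.1)) z (0, 1) = C • (g z).comp (A z) := by
  have hz' : z ∈ U ×ˢ Ico 0 ε := ⟨hz.1, Ioo_subset_Ico_self hz.2⟩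
  have hd : DifferentiableAt ℝ (fun z => truncate (g z) (N z.1)) z :=
    (h.contDiffOn_truncate.differentiableOn (by simp) z hz').differentiableAt
      (prod_mem_nhds (h.isOpen.mem_nhds hz.1) (Ico_mem_nhds hz.2.1 hz.2.2))
  have hcurve : HasDerivAt (fun s : ℝ => (z.1, s)) (0, 1) z.2 :=
    (hasDerivAt_const _ _).prodMk (hasDerivAt_id _)
  ext u v
  have h1 : HasDerivAt (fun s => truncate (g (z.1, s)) (N z.1) u v)
      (fderiv ℝ (fun z => truncate (g z) (N z.1)) z (0, 1) u v) z.2 := by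
    simpa using ((hd.hasFDerivAt.comp_hasDerivAt_of_eq z.2 hcurve rfl).clm_apply
      (hasDerivAt_const z.2 u)).clm_apply (hasDerivAt_const z.2 v)
  have h2 := ((h.evolution z hz' u v).hasDerivAt (Ico_mem_nhds hz.2.1 hz.2.2)).sub_const
    (g (z.1, 0) (N z.1) u * g (z.1, 0) (N z.1) v)
  refine h1.unique (h2.congr_of_eventuallyEq ?_)
  filter_upwards [Ico_mem_nhds hz.2.1 hz.2.2] with s hs
  rw [truncate_apply, h.normal_const (z.1, s) ⟨hz.1, hs⟩]

theorem continuousOn_trace_pow [FiniteDimensional ℝ E] (h : IsLocalFlow U ε C g N A) (hC : C ≠ 0)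
    (i : ℕ) :
    ContinuousOn (fun z => traceCLM E (A z ^ i)) (U ×ˢ Ico 0 ε) :=
  (traceCLM E).continuous.comp_continuousOn ((h.contDiffOn_weingarten hC).continuousOn.pow i)

/-- Lie transport along a curve with velocity `(C/2) N` is linear transport with `K = (C/2) DN`;
this puts the flow into the form of `hasDerivAt_trace_pow_of_transport`. -/
theorem hasDerivAt_trace_pow [FiniteDimensional ℝ E] (h : IsLocalFlow U ε C g N A) (hC : C ≠ 0)
    {z : ℝ → E × ℝ} {s : ℝ}
    (hz : HasDerivAt z ((C / 2) • N (z s).1, 1) s) (hzs : z s ∈ U ×ˢ Ioo 0 ε) (i : ℕ) :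
    HasDerivAt (fun r => traceCLM E (A (z r) ^ (i + 1))) 0 s := by
  have hΩ : IsOpen (U ×ˢ Ioo 0 ε) := h.isOpen.prod isOpen_Ioo
  have hsub : U ×ˢ Ioo 0 ε ⊆ U ×ˢ Ico 0 ε := prod_mono_right Ioo_subset_Ico_self
  have hnhds (z : E × ℝ) (hz : z ∈ U ×ˢ Ioo 0 ε) : U ×ˢ Ico 0 ε ∈ 𝓝 z :=
    mem_of_superset (hΩ.mem_nhds hz) hsub
  have hzsub := hsub hzs
  obtain ⟨hG, hB⟩ := hasDerivAt_of_lieTransport hΩ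
    (G := fun z => truncate (g z) (N z.1)) (B := fun z => (g z).comp (A z)) (N := N)
    (R := fun x => bilinAction (fderiv ℝ N x)) (C := C)
    ((h.contDiffOn_truncate.of_le (by norm_cast)).mono hsub)
    (((h.contDiffOn_secondForm hC).differentiableOn (by simp)).mono hsub)
    (fun z hz => by
      rw [h.eq_lieDerivative hC (hsub hz), fderivWithin_of_mem_nhds (hnhds z hz)])
    (fun z hz => h.fderiv_time hz) hz hzs
  have hA : DifferentiableAt ℝ A (z s) :=
    ((h.contDiffOn_weingarten hC).differentiableOn (by simp)).differentiableAt (hnhds _ hzs)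
  have hNd : DifferentiableAt ℝ N (z s).1 :=
    (h.contDiffOn_normal.contDiffAt (h.isOpen.mem_nhds hzs.1)).differentiableAt (by simp)
  have hz1 : HasDerivAt (fun r => (z r).1) ((C / 2) • N (z s).1) s := hz.fst
  have hev : ∀ᶠ r in 𝓝 s, z r ∈ U ×ˢ Ico 0 ε := hz.continuousAt.eventually_mem (hnhds _ hzs)
  have hu := h.unit _ hzsub
  have hA' : HasDerivAt (fun r => A (z r)) _ s := hA.hasFDerivAt.comp_hasDerivAt s hz
  refine hasDerivAt_trace_pow_of_transport (n := fun r => N (z r).1)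
    (K := (C / 2) • fderiv ℝ N (z s).1) (θ := g (z s) (N (z s).1)) hG hB hA' ?_ ?_ ?_ ?_ ?_ ?_ hu i
  · convert! hNd.hasFDerivAt.comp_hasDerivAt s hz1 using 1
    simp
  · intro u v
    simp [bilinAction_apply]
    ring
  · intro u v
    simp only [neg_smul, neg_apply, smul_apply, bilinAction_apply, map_smul, smul_eq_mul]
    ring
  -- Truncation does not affect `g(A u, v)`, since `g(N, A u) = g(A N, u) = 0` by symmetry.
  · filter_upwards [hev] with r hr u v
    have h0 : g (z r) (N (z r).1) (A (z r) u) = 0 := by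
      rw [h.symm _ hr, h.symm_weingarten hC hr, h.apply_normal _ hr, map_zero, zero_apply]
    rw [truncate_apply, h0, zero_mul, sub_zero]
    rfl
  · filter_upwards [hev] with r hr using h.apply_normal _ hr
  · intro w hw
    -- For `w' = w - g(N, w) N` one has `g(w', w') = G(w, w) = 0`, so `w' = 0` by positivity.
    refine ⟨g (z s) (N (z s).1) w, ?_⟩
    by_contra hne
    have h1 := h.pos _ hzsub _ (sub_ne_zero.2 hne)
    have h2 := hw w
    rw [truncate_apply] at h2
    simp only [map_sub, map_smul, sub_apply, smul_apply, smul_eq_mul, hu,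
      h.symm _ hzsub w (N (z s).1)] at h1
    linarith

end IsLocalFlow

end LocalFlow

/-! ### Coordinate frames, vector fields and brackets in a chart -/

section Coordinates

variable {E : Type*} [NormedAddCommGroup E] [NormedSpace ℝ E]
  {H : Type*} [TopologicalSpace H] {I : ModelWithCorners ℝ E H}
  {M : Type*} [TopologicalSpace M] [ChartedSpace H M] [IsManifold I ∞ M]

/-- The coordinate frame at `p` of the preferred chart at `x`: it sends a vector of the model space
to the tangent vector with these coordinates. -/
def coordFrame (I : ModelWithCorners ℝ E H) {M : Type*} [TopologicalSpace M] [ChartedSpace H M]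
    [IsManifold I 1 M] (x p : M) : E →L[ℝ] TangentSpace I p :=
  (trivializationAt E (TangentSpace I) x).symmL ℝ p

/-- The coordinates of tangent vectors at `p` in the preferred chart at `x`. -/
def coordMap (I : ModelWithCorners ℝ E H) {M : Type*} [TopologicalSpace M] [ChartedSpace H M]
    [IsManifold I 1 M] (x p : M) : TangentSpace I p →L[ℝ] E :=
  (trivializationAt E (TangentSpace I) x).continuousLinearMapAt ℝ p

variable {x p : M}

theorem mem_baseSet (hp : p ∈ (extChartAt I x).source) :
    p ∈ (trivializationAt E (TangentSpace I) x).baseSet := by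
  simpa using hp

theorem coordFrame_coordMap (hp : p ∈ (extChartAt I x).source) (v : TangentSpace I p) :
    coordFrame I x p (coordMap I x p v) = v :=
  Trivialization.symmL_continuousLinearMapAt _ (mem_baseSet hp) v

theorem coordMap_coordFrame (hp : p ∈ (extChartAt I x).source) (u : E) :
    coordMap I x p (coordFrame I x p u) = u :=
  Trivialization.continuousLinearMapAt_symmL _ (mem_baseSet hp) u

theorem contMDiffOn_coordFrame (u : E) :
    ContMDiffOn I I.tangent ∞ (fun p => (⟨p, coordFrame I x p u⟩ : TangentBundle I M))
      (extChartAt I x).source := by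
  have h := (trivializationAt E (TangentSpace I : M → Type _) x).contMDiffOn_symm (IB := I) (n := ∞)
  have h1 : ContMDiffOn I (I.prod 𝓘(ℝ, E)) ∞ (fun p : M => (p, u)) (extChartAt I x).source :=
    contMDiffOn_id.prodMk contMDiffOn_const
  refine (h.comp h1 fun p hp => ?_).congr fun p hp => ?_
  · exact (Trivialization.mem_target _).2 (mem_baseSet hp)
  · simp only [Function.comp_apply]
    rw [← Trivialization.mk_symm _ (mem_baseSet hp)]
    simp only [coordFrame]
    rw [Trivialization.symmL_apply _ (mem_baseSet hp)]

theorem mdifferentiableAt_coordFrame (hp : p ∈ (extChartAt I x).source) (u : E) :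
    MDiffAt (T% (fun p => coordFrame I x p u)) p :=
  ((contMDiffOn_coordFrame u).contMDiffAt
    ((isOpen_extChartAt_source x).mem_nhds hp)).mdifferentiableAt (by simp)

/-- The coordinate representation of a vector field in the preferred chart at `x`. -/
def localField (I : ModelWithCorners ℝ E H) {M : Type*} [TopologicalSpace M] [ChartedSpace H M]
    [IsManifold I 1 M] (V : (p : M) → TangentSpace I p) (x : M) (y : E) : E :=
  coordMap I x ((extChartAt I x).symm y) (V ((extChartAt I x).symm y))

theorem contDiffOn_localField {V : (p : M) → TangentSpace I p}
    (hV : ContMDiff I I.tangent ∞ (fun p => (⟨p, V p⟩ : TangentBundle I M))) :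
    ContDiffOn ℝ ∞ (localField I V x) (extChartAt I x).target := by
  have h1 := ((trivializationAt E (TangentSpace I : M → Type _) x).contMDiffOn_section_baseSet_iff
    (IB := I) (n := ∞) (s := V)).1 hV.contMDiffOn
  have h2 := h1.comp (contMDiffOn_extChartAt_symm x)
    fun y hy => mem_baseSet ((extChartAt I x).map_target hy)
  refine h2.contDiffOn.congr fun y hy => ?_
  simp only [localField, coordMap, Function.comp_apply]
  rw [Trivialization.continuousLinearMapAt_apply,
    Trivialization.linearMapAt_apply, if_pos (mem_baseSet ((extChartAt I x).map_target hy))]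

variable [I.Boundaryless]

/-- This identifies the frame taken from the tangent bundle trivialization with the differential of
the inverse chart, so that derivatives on `M` become derivatives in coordinates. -/
theorem mfderiv_extChartAt_symm {y : E} (hy : y ∈ (extChartAt I x).target) :
    mfderiv 𝓘(ℝ, E) I (extChartAt I x).symm y = coordFrame I x ((extChartAt I x).symm y) := by
  have hp := (extChartAt I x).map_target hy
  have h := TangentBundle.symmL_trivializationAt (I := I) (x₀ := x)
    (x := (extChartAt I x).symm y) (by simpa using hp)
  rw [I.range_eq_univ, mfderivWithin_univ] at h
  have h2 : ∀ y', y' = y → (mfderiv 𝓘(ℝ, E) I (extChartAt I x).symm y' : E →L[ℝ] E)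
      = (mfderiv 𝓘(ℝ, E) I (extChartAt I x).symm y : E →L[ℝ] E) := by
    rintro y' rfl; rfl
  exact (h2 _ ((extChartAt I x).right_inv hy)).symm.trans h.symm

theorem inverse_mfderiv_extChartAt_symm {y : E} (hy : y ∈ (extChartAt I x).target) :
    (mfderiv 𝓘(ℝ, E) I (extChartAt I x).symm y).inverse =
      coordMap I x ((extChartAt I x).symm y) := by
  rw [mfderiv_extChartAt_symm hy]
  have hp := (extChartAt I x).map_target hy
  refine ContinuousLinearMap.inverse_eq ?_ ?_
  · ext v; exact coordFrame_coordMap hp v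
  · ext u; exact coordMap_coordFrame hp u

theorem contMDiffAt_extChartAt_symm {y : E} (hy : y ∈ (extChartAt I x).target) :
    ContMDiffAt 𝓘(ℝ, E) I ∞ (extChartAt I x).symm y :=
  (contMDiffOn_extChartAt_symm x).contMDiffAt ((isOpen_extChartAt_target x).mem_nhds hy)

theorem mvfderiv_coordFrame {y : E} (hy : y ∈ (extChartAt I x).target) {F : Type*}
    [NormedAddCommGroup F] [NormedSpace ℝ F] {f : M → F}
    (hf : MDifferentiableAt I 𝓘(ℝ, F) f ((extChartAt I x).symm y)) (u : E) :
    d% f ((extChartAt I x).symm y) (coordFrame I x ((extChartAt I x).symm y) u) =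
      fderiv ℝ (fun y => f ((extChartAt I x).symm y)) y u := by
  have h1 := mfderiv_comp y hf ((contMDiffAt_extChartAt_symm hy).mdifferentiableAt (by simp))
  rw [mfderiv_eq_fderiv, mfderiv_extChartAt_symm hy] at h1
  exact (congrArg (fun L : E →L[ℝ] F => L u) h1).symm

theorem mpullback_extChartAt_symm (V : (p : M) → TangentSpace I p) {y : E}
    (hy : y ∈ (extChartAt I x).target) :
    mpullback 𝓘(ℝ, E) I (extChartAt I x).symm V y =
      coordMap I x ((extChartAt I x).symm y) (V ((extChartAt I x).symm y)) := by
  rw [mpullback_apply, inverse_mfderiv_extChartAt_symm hy]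
  rfl

variable [CompleteSpace E]

/-- The bracket is natural under pullback by the inverse chart; the frame field becomes the constant
`u`, and the bracket of a constant field with `V` is the derivative of `V` in the direction `u`. -/
theorem mlieBracket_coordFrame {V : (p : M) → TangentSpace I p}
    (hV : ContMDiff I I.tangent ∞ (fun p => (⟨p, V p⟩ : TangentBundle I M))) {y : E}
    (hy : y ∈ (extChartAt I x).target) (u : E) :
    mlieBracket I (fun p => coordFrame I x p u) V ((extChartAt I x).symm y) =
      coordFrame I x ((extChartAt I x).symm y) (fderiv ℝ (localField I V x) y u) := by
  have hp := (extChartAt I x).map_target hy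
  have : IsManifold I (minSmoothness ℝ 2) M := IsManifold.of_le (n := ∞) (by simp; norm_cast)
  have h1 := mpullback_mlieBracket (I := 𝓘(ℝ, E)) (I' := I) (n := ∞) (f := (extChartAt I x).symm)
    (x₀ := y) (V := fun p => coordFrame I x p u) (W := V)
    (mdifferentiableAt_coordFrame hp u) (hV.mdifferentiable (by simp) _)
    (contMDiffAt_extChartAt_symm hy) (by simp; norm_cast)
  have hn := (isOpen_extChartAt_target (I := I) x).mem_nhds hy
  have e1 : mpullback 𝓘(ℝ, E) I (extChartAt I x).symm (fun p => coordFrame I x p u)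
      =ᶠ[𝓝 y] fun _ => u := by
    filter_upwards [hn] with y hy
    rw [mpullback_extChartAt_symm _ hy, coordMap_coordFrame ((extChartAt I x).map_target hy)]
  have e2 : mpullback 𝓘(ℝ, E) I (extChartAt I x).symm V =ᶠ[𝓝 y] localField I V x := by
    filter_upwards [hn] with y hy
    rw [mpullback_extChartAt_symm _ hy, localField]
  have h2 : mlieBracket 𝓘(ℝ, E) (mpullback 𝓘(ℝ, E) I (extChartAt I x).symm
      (fun p => coordFrame I x p u)) (mpullback 𝓘(ℝ, E) I (extChartAt I x).symm V) y
      = lieBracket ℝ (mpullback 𝓘(ℝ, E) I (extChartAt I x).symm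
      (fun p => coordFrame I x p u) : E → E) (mpullback 𝓘(ℝ, E) I (extChartAt I x).symm V) y := by
    rw [← mlieBracketWithin_univ, mlieBracketWithin_eq_lieBracketWithin]
    exact congrFun lieBracketWithin_univ y
  have h3 : lieBracket ℝ (fun _ => u) (localField I V x) y = fderiv ℝ (localField I V x) y u := by
    simp [lieBracket]
  have h4 := ((mpullback_extChartAt_symm _ hy).symm.trans h1).trans (h2.trans
    ((Filter.EventuallyEq.lieBracket_vectorField_eq e1 e2).trans h3))
  rw [← coordFrame_coordMap hp (mlieBracket I (fun p => coordFrame I x p u) V _)]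
  exact congrArg _ h4

end Coordinates

/-! ### The metric and the Koszul formula in coordinates -/

section LocalMetric

variable {E : Type*} [NormedAddCommGroup E] [NormedSpace ℝ E]
  {H : Type*} [TopologicalSpace H] {I : ModelWithCorners ℝ E H}
  {M : Type*} [TopologicalSpace M] [ChartedSpace H M] [IsManifold I ∞ M]

/-- The coordinate expression at `y`, in the preferred chart at `x`, of a field `β` of bilinear
forms. -/
def localBilin (I : ModelWithCorners ℝ E H) {M : Type*} [TopologicalSpace M] [ChartedSpace H M]
    [IsManifold I 1 M] (β : (p : M) → TangentSpace I p →L[ℝ] TangentSpace I p →L[ℝ] ℝ) (x : M)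
    (y : E) : E →L[ℝ] E →L[ℝ] ℝ :=
  (ContinuousLinearMap.precomp ℝ (coordFrame I x ((extChartAt I x).symm y))).comp
    ((β ((extChartAt I x).symm y)).comp (coordFrame I x ((extChartAt I x).symm y)))

theorem localBilin_apply (β : (p : M) → TangentSpace I p →L[ℝ] TangentSpace I p →L[ℝ] ℝ) (x : M)
    (y u v : E) : localBilin I β x y u v = β ((extChartAt I x).symm y)
      (coordFrame I x ((extChartAt I x).symm y) u) (coordFrame I x ((extChartAt I x).symm y) v) :=
  rfl

/-- In finite dimension, smoothness of a family of bilinear forms can be tested on fixed vectors,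
and these correspond to the smooth frame fields. -/
theorem contDiffOn_localBilin [FiniteDimensional ℝ E]
    {β : ℝ → (p : M) → TangentSpace I p →L[ℝ] TangentSpace I p →L[ℝ] ℝ} {S : Set ℝ}
    (hβ : ContMDiffOn (I.prod 𝓘(ℝ, ℝ)) (I.prod 𝓘(ℝ, E →L[ℝ] E →L[ℝ] ℝ)) ∞
      (fun z : M × ℝ => TotalSpace.mk' (E →L[ℝ] E →L[ℝ] ℝ)
        (E := fun p : M => TangentSpace I p →L[ℝ] TangentSpace I p →L[ℝ] ℝ) z.1 (β z.2 z.1))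
      (univ ×ˢ S)) (x : M) :
    ContDiffOn ℝ ∞ (fun z : E × ℝ => localBilin I (β z.2) x z.1)
      ((extChartAt I x).target ×ˢ S) := by
  rw [contDiffOn_clm_apply]
  intro u
  rw [contDiffOn_clm_apply]
  intro v
  have hfst : ContMDiffOn 𝓘(ℝ, E × ℝ) I ∞ (fun z : E × ℝ => (extChartAt I x).symm z.1)
      ((extChartAt I x).target ×ˢ S) :=
    (contMDiffOn_extChartAt_symm x).comp (contMDiff_iff_contDiff.2 contDiff_fst).contMDiffOn
      fun z hz => hz.1
  have hmap : ContMDiffOn 𝓘(ℝ, E × ℝ) (I.prod 𝓘(ℝ, ℝ)) ∞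
      (fun z : E × ℝ => ((extChartAt I x).symm z.1, z.2)) ((extChartAt I x).target ×ˢ S) :=
    hfst.prodMk (contMDiff_iff_contDiff.2 contDiff_snd).contMDiffOn
  have hβ' := hβ.comp hmap fun z hz => ⟨mem_univ _, hz.2⟩
  have hframe (u : E) : ContMDiffOn 𝓘(ℝ, E × ℝ) (I.prod 𝓘(ℝ, E)) ∞
      (fun z : E × ℝ => TotalSpace.mk' E (E := fun p : M => TangentSpace I p)
        ((extChartAt I x).symm z.1) (coordFrame I x ((extChartAt I x).symm z.1) u))
      ((extChartAt I x).target ×ˢ S) :=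
    (contMDiffOn_coordFrame u).comp hfst fun z hz => (extChartAt I x).map_target hz.1
  have h : ContMDiffOn 𝓘(ℝ, E × ℝ) (I.prod 𝓘(ℝ, ℝ)) ∞
      (fun z : E × ℝ => TotalSpace.mk' ℝ (E := Bundle.Trivial M ℝ) ((extChartAt I x).symm z.1)
        (localBilin I (β z.2) x z.1 u v)) ((extChartAt I x).target ×ˢ S) := by
    apply ContMDiffOn.clm_bundle_apply₂ (F₁ := E) (F₂ := E)
    · exact hβ'
    · exact hframe u
    · exact hframe v
  intro z hz
  have h1 := h z hz
  rw [contMDiffWithinAt_totalSpace] at h1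
  exact contMDiffWithinAt_iff_contDiffWithinAt.1 h1.2

variable [FiniteDimensional ℝ E] [CompleteSpace E]

/-- The symmetrized covariant derivative of a vector field is the Lie derivative of the metric. -/
theorem inner_leviCivita_add_inner_leviCivita
    (g : ContMDiffRiemannianMetric I ∞ E (fun p : M => TangentSpace I p))
    {X Y N : (p : M) → TangentSpace I p} {p : M} (hX : MDiffAt (T% X) p) (hY : MDiffAt (T% Y) p)
    (hN : MDiffAt (T% N) p) :
    g.inner p (leviCivita g N p (X p)) (Y p) + g.inner p (leviCivita g N p (Y p)) (X p) =
      d% (fun p => g.inner p (X p) (Y p)) p (N p) + g.inner p (mlieBracket I X N p) (Y p)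
        + g.inner p (X p) (mlieBracket I Y N p) := by
  have h1 : g.inner p (leviCivita g N p (X p)) (Y p) = _ := inner_leviCivitaFun g hX hN hY
  have h2 : g.inner p (leviCivita g N p (Y p)) (X p) = _ := inner_leviCivitaFun g hY hN hX
  rw [h1, h2]
  have e (X Y : (p : M) → TangentSpace I p) :
      (fun p => g.inner p (Y p) (X p)) = fun p => g.inner p (X p) (Y p) := by
    ext p; exact g.symm p _ _
  simp only [koszulForm, e X Y, e X N, e Y N, mlieBracket_swap_apply (I := I) (V := N) (W := X),
    mlieBracket_swap_apply (I := I) (V := N) (W := Y),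
    mlieBracket_swap_apply (I := I) (V := Y) (W := X), g.symm p (X p)]
  simp
  ring

variable [I.Boundaryless]

theorem inner_leviCivita_coordFrame
    (g : ContMDiffRiemannianMetric I ∞ E (fun p : M => TangentSpace I p))
    {N : (p : M) → TangentSpace I p} {x : M}
    (hN : ContMDiff I I.tangent ∞ (fun p => (⟨p, N p⟩ : TangentBundle I M))) {y : E}
    (hy : y ∈ (extChartAt I x).target) (hg : DifferentiableAt ℝ (localBilin I g.inner x) y)
    (u v : E) :
    g.inner _ (leviCivita g N _ (coordFrame I x ((extChartAt I x).symm y) u))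
        (coordFrame I x ((extChartAt I x).symm y) v)
      + g.inner _ (leviCivita g N _ (coordFrame I x ((extChartAt I x).symm y) v))
        (coordFrame I x ((extChartAt I x).symm y) u) =
      fderiv ℝ (localBilin I g.inner x) y (localField I N x y) u v
        + localBilin I g.inner x y (fderiv ℝ (localField I N x) y u) v
        + localBilin I g.inner x y u (fderiv ℝ (localField I N x) y v) := by
  have hp := (extChartAt I x).map_target hy
  have h := inner_leviCivita_add_inner_leviCivita g (mdifferentiableAt_coordFrame hp u)
    (mdifferentiableAt_coordFrame hp v) (hN.mdifferentiable (by simp) _)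
  rw [mlieBracket_coordFrame hN hy, mlieBracket_coordFrame hN hy] at h
  have h1 := mvfderiv_coordFrame hy
    (metric_mdiffAt g (mdifferentiableAt_coordFrame hp u) (mdifferentiableAt_coordFrame hp v))
    (localField I N x y)
  rw [localField, coordFrame_coordMap hp] at h1
  rw [h1] at h
  have h2 : HasFDerivAt (fun y => localBilin I g.inner x y u v)
      ((ContinuousLinearMap.apply ℝ ℝ v).comp ((ContinuousLinearMap.apply ℝ (E →L[ℝ] ℝ) u).comp
        (fderiv ℝ (localBilin I g.inner x) y))) y :=
    (ContinuousLinearMap.apply ℝ ℝ v).hasFDerivAt.comp y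
      ((ContinuousLinearMap.apply ℝ (E →L[ℝ] ℝ) u).hasFDerivAt.comp y hg.hasFDerivAt)
  have h3 := h2.fderiv
  simp only [localBilin_apply] at h3
  rw [h3] at h
  exact h

end LocalMetric

/-! ### The unit normal at a point does not depend on time -/

section NormalAtPoint

variable {E : Type*} [NormedAddCommGroup E] [NormedSpace ℝ E] [FiniteDimensional ℝ E]

theorem differentiableWithinAt_clm_of_apply {F : Type*} [NormedAddCommGroup F] [NormedSpace ℝ F]
    {f : ℝ → E →L[ℝ] F} {S : Set ℝ} {t : ℝ}
    (h : ∀ v, DifferentiableWithinAt ℝ (fun s => f s v) S t) : DifferentiableWithinAt ℝ f S t := by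
  let b := Module.finBasis ℝ E
  have hf : f = fun s => ∑ i, (ContinuousLinearMap.smulRightL ℝ E F
      (LinearMap.toContinuousLinearMap (b.coord i))) (f s (b i)) := by
    ext s v
    conv_lhs => rw [← b.sum_repr v, map_sum]
    simp
  rw [hf]
  exact DifferentiableWithinAt.fun_sum fun i _ =>
    (ContinuousLinearMap.differentiableAt _).comp_differentiableWithinAt t (h (b i))

/-- If the time derivative of a family of inner products annihilates the unit normal of a fixed
hyperplane at each time, then this normal is constant. -/
theorem unitNormal_const {ε : ℝ} {g b : ℝ → E →L[ℝ] E →L[ℝ] ℝ}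
    {N : ℝ → E} {ν : E} {α : E →L[ℝ] ℝ}
    (hpos : ∀ t ∈ Ico 0 ε, ∀ u ≠ 0, 0 < g t u u)
    (hder : ∀ t ∈ Ico 0 ε, ∀ u v, HasDerivWithinAt (fun s => g s u v) (b t u v) (Ico 0 ε) t)
    (hunit : ∀ t ∈ Ico 0 ε, g t (N t) (N t) = 1)
    (hnormal : ∀ t ∈ Ico 0 ε, ∀ v, α v = 0 → g t (N t) v = 0)
    (hν : ∀ t ∈ Ico 0 ε, 0 < g t (N t) ν) (hb : ∀ t ∈ Ico 0 ε, ∀ v, b t (N t) v = 0)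
    {t : ℝ} (ht : t ∈ Ico 0 ε) : N t = N 0 := by
  have h0 : (0 : ℝ) ∈ Ico 0 ε := ⟨le_rfl, ht.1.trans_lt ht.2⟩
  have hαν : α ν ≠ 0 := fun h => (hν t ht).ne' (hnormal t ht ν h)
  have hinv (t) (ht : t ∈ Ico 0 ε) := isInvertible_of_pos (hpos t ht)
  have hcomp := FiniteDimensional.complete ℝ E
  -- No continuity of `N` in `t` is assumed. It is replaced by the vector `m` dual to `α`, which is
  -- differentiable because the metric is; `N` is a multiple `c m`.
  set m : ℝ → E := fun t => (g t).inverse α with hm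
  have hgm (t) (ht : t ∈ Ico 0 ε) : g t (m t) = α := by
    obtain ⟨e, he⟩ := hinv t ht
    simp [hm, ← he]
  set c : ℝ → ℝ := fun t => g t (N t) ν / α ν with hc
  have hNm (t) (ht : t ∈ Ico 0 ε) : N t = c t • m t := by
    obtain ⟨e, he⟩ := hinv t ht
    apply e.injective
    have h1 : g t (N t) = g t (c t • m t) := by
      rw [map_smul, hgm t ht]
      ext v
      have h2 := hnormal t ht (v - (α v / α ν) • ν) (by simp [hαν])
      rw [map_sub, map_smul, sub_eq_zero] at h2
      rw [h2, smul_apply, smul_eq_mul, smul_eq_mul, hc]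
      ring
    rw [← he] at h1
    exact h1
  have hc0 (t) (ht : t ∈ Ico 0 ε) : c t ≠ 0 := div_ne_zero (hν t ht).ne' hαν
  have hmder (t) (ht : t ∈ Ico 0 ε) : HasDerivWithinAt m 0 (Ico 0 ε) t := by
    have hgd : DifferentiableWithinAt ℝ g (Ico 0 ε) t :=
      differentiableWithinAt_clm_of_apply fun u => differentiableWithinAt_clm_of_apply fun v =>
        (hder t ht u v).differentiableWithinAt
    have hmd : DifferentiableWithinAt ℝ m (Ico 0 ε) t := by
      have h1 : DifferentiableAt ℝ ContinuousLinearMap.inverse (g t) :=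
        ((hinv t ht).contDiffAt_map_inverse (n := 1)).differentiableAt (by simp)
      exact (h1.comp_differentiableWithinAt t hgd).clm_apply (differentiableWithinAt_const α)
    have hu := uniqueDiffOn_Ico 0 ε t ht
    have h1 := hgd.hasDerivWithinAt.clm_apply hmd.hasDerivWithinAt
    have h2 : HasDerivWithinAt (fun s => g s (m s)) 0 (Ico 0 ε) t :=
      (hasDerivWithinAt_const t _ α).congr hgm (hgm t ht)
    have h3 := UniqueDiffWithinAt.eq_deriv _ hu h1 h2
    -- As `m` is proportional to `N`, it is annihilated by `∂_t g`; so differentiating `g m = α`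
    -- leaves `g m' = 0`.
    have h4 : derivWithin g (Ico 0 ε) t (m t) = 0 := by
      have h5 : m t = (c t)⁻¹ • N t := by rw [hNm t ht, inv_smul_smul₀ (hc0 t ht)]
      ext v
      have h6 := (hgd.hasDerivWithinAt.clm_apply (hasDerivWithinAt_const t _ (m t))).clm_apply
        (hasDerivWithinAt_const t _ v)
      have h7 := UniqueDiffWithinAt.eq_deriv _ hu h6 (hder t ht (m t) v)
      simp only [map_zero, add_zero] at h7
      rw [h7, h5, map_smul, smul_apply, hb t ht, smul_zero, zero_apply]
    rw [h4, zero_add] at h3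
    have h8 : derivWithin m (Ico 0 ε) t = 0 := by
      obtain ⟨e, he⟩ := hinv t ht
      rw [← he] at h3
      exact e.injective (h3.trans e.map_zero.symm)
    have h9 := hmd.hasDerivWithinAt
    rwa [h8] at h9
  have hmconst : m t = m 0 := by
    refine Convex.is_const_of_fderivWithin_eq_zero (𝕜 := ℝ) (convex_Ico 0 ε)
      (fun s hs => (hmder s hs).differentiableWithinAt) (fun s hs => ?_) ht h0
    ext
    exact (hmder s hs).derivWithin (uniqueDiffOn_Ico 0 ε s hs)
  -- The unit length determines `c ^ 2`, because `α m` is constant; the sign of `c` is then fixed by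
  -- positivity against `ν`.
  have hsq (t) (ht : t ∈ Ico 0 ε) : c t * (c t * α (m t)) = 1 := by
    have := hunit t ht
    rw [hNm t ht] at this
    simpa [hgm t ht] using this
  have h1 := hsq t ht
  have h2 := hsq 0 h0
  rw [hmconst] at h1
  have hne : α (m 0) ≠ 0 := fun h => by simp [h] at h2
  have h3 : c t ^ 2 = c 0 ^ 2 := by
    refine mul_right_cancel₀ hne ?_
    linear_combination h1 - h2
  have hsign : 0 < c t * c 0 := by
    have e : c t * c 0 = (g t (N t) ν * g 0 (N 0) ν) / α ν ^ 2 := by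
      simp only [hc]; ring
    rw [e]
    exact div_pos (mul_pos (hν t ht) (hν 0 h0)) (by positivity)
  have h4 : c t = c 0 := by
    rcases sq_eq_sq_iff_eq_or_eq_neg.1 h3 with h | h
    · exact h
    · rw [h] at hsign
      nlinarith [sq_nonneg (c 0)]
  rw [hNm t ht, hNm 0 h0, h4, hmconst]

end NormalAtPoint

/-! ### Tangent hyperplanes of the foliation -/

section Foliation

variable {n : ℕ} {M : Type*} [TopologicalSpace M]
  [ChartedSpace (EuclideanSpace ℝ (Fin (n + 1))) M]

/-- The vectors tangent to a codimension-one foliation contain a hyperplane at each point. -/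
theorem Foliation.exists_ker_isTangent (F : Foliation n M) (q : M) :
    ∃ α : TangentSpace (𝓡 (n + 1)) q →L[ℝ] ℝ, ∀ v, α v = 0 → F.IsTangent q v := by
  obtain ⟨e, he, hq, hq0, hslice⟩ := F.exists_chart q
  obtain ⟨L, hL, hqL⟩ : ∃ L ∈ F.leaves, q ∈ L := by
    have : q ∈ ⋃₀ F.leaves := F.cover ▸ mem_univ q
    simpa using this
  let d : EuclideanSpace ℝ (Fin (n + 1)) →L[ℝ] EuclideanSpace ℝ (Fin (n + 1)) :=
    mfderiv (𝓡 (n + 1)) (𝓡 (n + 1)) e q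
  -- The covector is the differential of the last coordinate of a foliated chart centred at `q`.
  refine ⟨(EuclideanSpace.proj (Fin.last n)).comp d, fun v hv => ?_⟩
  set u := d v with hu
  have hulast : u (Fin.last n) = 0 := hv
  have hmd : e.MDifferentiable (𝓡 (n + 1)) (𝓡 (n + 1)) :=
    ⟨(contMDiffOn_of_mem_maximalAtlas he).mdifferentiableOn (by simp),
      (contMDiffOn_symm_of_mem_maximalAtlas he).mdifferentiableOn (by simp)⟩
  have htgt : (0 : EuclideanSpace ℝ (Fin (n + 1))) ∈ e.target := hq0 ▸ e.map_source hq
  have hline : HasFDerivAt (fun s : ℝ => s • u) ((1 : ℝ →L[ℝ] ℝ).smulRight u) 0 :=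
    (hasDerivAt_id (0 : ℝ)).smul_const u |>.hasFDerivAt.congr_fderiv (by ext; simp)
  have hev : ∀ᶠ s : ℝ in 𝓝 0, s • u ∈ e.target :=
    hline.continuousAt.eventually_mem (by simpa using e.open_target.mem_nhds htgt)
  -- A straight line through `e q = 0` with vanishing last coordinate stays in the slice through the
  -- centre, which is contained in the image of the leaf.
  refine ⟨L, hL, fun s => e.symm (s • u), ?_, ?_, ?_⟩
  · have h1 : ContMDiffAt (𝓡 (n + 1)) (𝓡 (n + 1)) ∞ e.symm ((0 : ℝ) • u) := by
      rw [zero_smul]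
      exact (contMDiffOn_symm_of_mem_maximalAtlas he).contMDiffAt (e.open_target.mem_nhds htgt)
    exact h1.comp (0 : ℝ) (contMDiff_iff_contDiff.2 (contDiff_id.smul contDiff_const)).contMDiffAt
  · filter_upwards [hev] with s hs
    have h1 : s • u ∈ connectedComponentIn (e '' (e.source ∩ L)) (e q) := by
      rw [hslice L hL q ⟨hq, hqL⟩]
      exact ⟨hs, by simp [hulast, hq0]⟩
    obtain ⟨p, hp, hps⟩ := connectedComponentIn_subset _ _ h1
    rw [← hps, e.left_inv hp.1]
    exact hp.2
  · have hsymm : ∀ z, z = e q → HasMFDerivAt (𝓡 (n + 1)) (𝓡 (n + 1)) e.symm z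
        (mfderiv (𝓡 (n + 1)) (𝓡 (n + 1)) e.symm (e q) :
          EuclideanSpace ℝ (Fin (n + 1)) →L[ℝ] EuclideanSpace ℝ (Fin (n + 1))) := by
      rintro z rfl
      exact (hmd.mdifferentiableAt_symm (e.map_source hq)).hasMFDerivAt
    have h1 := (hsymm ((0 : ℝ) • u) (by rw [hq0, zero_smul])).comp (0 : ℝ) hline.hasMFDerivAt
    have h2 : (mfderiv (𝓡 (n + 1)) (𝓡 (n + 1)) e.symm (e q) :
          EuclideanSpace ℝ (Fin (n + 1)) →L[ℝ] EuclideanSpace ℝ (Fin (n + 1))) u = v :=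
      congrArg (fun T : EuclideanSpace ℝ (Fin (n + 1)) →L[ℝ] EuclideanSpace ℝ (Fin (n + 1)) => T v)
        (hmd.symm_comp_deriv hq)
    have h3 := h1.mfderiv
    have hmk : ∀ (p : M) (w : TangentSpace (𝓡 (n + 1)) p), p = q →
        (w : EuclideanSpace ℝ (Fin (n + 1))) = (v : EuclideanSpace ℝ (Fin (n + 1))) →
        (⟨p, w⟩ : TangentBundle (𝓡 (n + 1)) M) = ⟨q, v⟩ := by
      rintro p w rfl h; exact congrArg _ h
    refine hmk _ _ ?_ ?_
    · simp only [zero_smul]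
      rw [← hq0, e.left_inv hq]
    · refine (congrArg (fun T : ℝ →L[ℝ] EuclideanSpace ℝ (Fin (n + 1)) => T 1) h3).trans ?_
      refine Eq.trans ?_ h2
      change (mfderiv (𝓡 (n + 1)) (𝓡 (n + 1)) e.symm (e q) :
          EuclideanSpace ℝ (Fin (n + 1)) →L[ℝ] EuclideanSpace ℝ (Fin (n + 1))) ((1 : ℝ) • u) = _
      rw [one_smul]

end Foliation

/-! ### Weingarten operator, power sums and the fixed normal on the manifold -/

section Evolution

variable {n : ℕ} {M : Type*} [TopologicalSpace M]
  [ChartedSpace (EuclideanSpace ℝ (Fin (n + 1))) M] [IsManifold (𝓡 (n + 1)) ∞ M]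

theorem tangentialPart_apply (g : RMetric n M) (N : VField n M) (p : M)
    (v : TangentSpace (𝓡 (n + 1)) p) :
    tangentialPart g N p v = v - g.inner p (N p) v • N p := rfl

theorem tangentialPart_normal {g : RMetric n M} {N : VField n M} {p : M}
    (h : g.inner p (N p) (N p) = 1) : tangentialPart g N p (N p) = 0 := by
  rw [tangentialPart_apply, h, one_smul, sub_self]

theorem tangentialPart_of_inner_eq_zero {g : RMetric n M} {N : VField n M} {p : M}
    {v : TangentSpace (𝓡 (n + 1)) p} (h : g.inner p (N p) v = 0) : tangentialPart g N p v = v := by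
  rw [tangentialPart_apply, h, zero_smul, sub_zero]

theorem weingarten_apply (g : RMetric n M) (N : VField n M) (p : M)
    (v : TangentSpace (𝓡 (n + 1)) p) :
    weingarten g N p v = -leviCivita g N p (tangentialPart g N p v) := rfl

theorem inner_tangentialPart {g : RMetric n M} {N : VField n M} {p : M}
    (h : g.inner p (N p) (N p) = 1) (v : TangentSpace (𝓡 (n + 1)) p) :
    g.inner p (N p) (tangentialPart g N p v) = 0 := by
  rw [tangentialPart_apply, map_sub, map_smul, h, smul_eq_mul, mul_one, sub_self]

theorem weingarten_tangentialPart {g : RMetric n M} {N : VField n M} {p : M}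
    (h : g.inner p (N p) (N p) = 1) (v : TangentSpace (𝓡 (n + 1)) p) :
    weingarten g N p (tangentialPart g N p v) = weingarten g N p v := by
  rw [weingarten_apply, weingarten_apply,
    tangentialPart_of_inner_eq_zero (inner_tangentialPart h v)]

/-- The Weingarten operator takes values in the tangent spaces of the leaves. -/
theorem inner_weingarten_normal {g : RMetric n M} {N : VField n M} (hN : IsSmoothField N)
    (h : ∀ p, g.inner p (N p) (N p) = 1) {p : M} (v : TangentSpace (𝓡 (n + 1)) p) :
    g.inner p (weingarten g N p v) (N p) = 0 := by
  have hNd : MDifferentiableAt (𝓡 (n + 1)) (𝓡 (n + 1)).tangent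
      (fun p => (⟨p, N p⟩ : TangentBundle (𝓡 (n + 1)) M)) p := hN.mdifferentiable (by simp) p
  have hw := FiberBundle.mdifferentiableAt_extend (𝓡 (n + 1)) (EuclideanSpace ℝ (Fin (n + 1)))
    (tangentialPart g N p v)
  have h1 := leviCivita_metric g hw hNd hNd
  rw [FiberBundle.extend_apply_self, show (fun p => g.inner p (N p) (N p)) = fun _ => (1 : ℝ) from
    funext h, g.symm p (N p)] at h1
  have h2 : mvfderiv (𝓡 (n + 1)) (fun _ : M => (1 : ℝ)) p (tangentialPart g N p v) = 0 := by
    simp [mvfderiv]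
  rw [h2] at h1
  rw [weingarten_apply, map_neg, neg_apply]
  linarith

/-- The projection of `v` is already built into the Weingarten operator, and that of `w` is harmless
because `A v` is orthogonal to `N`. -/
theorem bHat_one {g : RMetric n M} {N : VField n M} (hN : IsSmoothField N)
    (h : ∀ p, g.inner p (N p) (N p) = 1) {p : M} (v w : TangentSpace (𝓡 (n + 1)) p) :
    bHat g N 1 p v w = g.inner p (weingarten g N p v) w := by
  rw [bHat, pow_one, weingarten_tangentialPart (h p), tangentialPart_apply g N p w, map_sub,
    map_smul, inner_weingarten_normal hN h, smul_zero, sub_zero]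

theorem powerSum_zero {g : RMetric n M} {N : VField n M} {p : M}
    (h : g.inner p (N p) (N p) = 1) : powerSum g N 0 p = n := by
  have key : ∀ (θ : EuclideanSpace ℝ (Fin (n + 1)) →ₗ[ℝ] ℝ) (w : EuclideanSpace ℝ (Fin (n + 1))),
      θ w = 1 → LinearMap.trace ℝ (EuclideanSpace ℝ (Fin (n + 1)))
        (LinearMap.id - θ.smulRight w) = n := by
    intro θ w hw
    rw [map_sub, LinearMap.trace_smulRight, LinearMap.trace_id, hw, finrank_euclideanSpace_fin]
    simp
  exact key (g.inner p (N p)).toLinearMap (N p) h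

theorem powerSum_succ {g : RMetric n M} {N : VField n M} {p : M}
    (h : g.inner p (N p) (N p) = 1) (i : ℕ) :
    powerSum g N (i + 1) p = LinearMap.trace ℝ (TangentSpace (𝓡 (n + 1)) p)
      (weingarten g N p ^ (i + 1)).toLinearMap := by
  rw [powerSum]
  congr 1
  ext1 v
  change (weingarten g N p ^ (i + 1)) (tangentialPart g N p v) = (weingarten g N p ^ (i + 1)) v
  rw [pow_succ]
  change (weingarten g N p ^ i) (weingarten g N p _) = (weingarten g N p ^ i) (weingarten g N p _)
  rw [weingarten_tangentialPart h]

theorem eq_of_hasDerivWithinAt_zero {f : ℝ → ℝ} {ε : ℝ}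
    (hf : ∀ s ∈ Ico 0 ε, HasDerivWithinAt f 0 (Ico 0 ε) s) {t : ℝ} (ht : t ∈ Ico 0 ε) :
    f t = f 0 := by
  refine Convex.is_const_of_fderivWithin_eq_zero (𝕜 := ℝ) (convex_Ico 0 ε)
    (fun s hs => (hf s hs).differentiableWithinAt) (fun s hs => ?_) ht
    ⟨le_rfl, ht.1.trans_lt ht.2⟩
  ext
  exact (hf s hs).derivWithin (uniqueDiffOn_Ico 0 ε s hs)

/-- The flow `∂_t g = C b̂_1` of metrics adapted to a transversely oriented foliation. -/
structure IsSecondFormFlow (F : Foliation n M) (ν : VField n M) (C ε : ℝ) (g : ℝ → RMetric n M)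
    (N : ℝ → VField n M) : Prop where
  smooth : ContMDiffOn ((𝓡 (n + 1)).prod 𝓘(ℝ, ℝ))
    ((𝓡 (n + 1)).prod 𝓘(ℝ, EuclideanSpace ℝ (Fin (n + 1)) →L[ℝ]
      EuclideanSpace ℝ (Fin (n + 1)) →L[ℝ] ℝ)) ∞
    (fun z : M × ℝ => TotalSpace.mk' (EuclideanSpace ℝ (Fin (n + 1)) →L[ℝ]
      EuclideanSpace ℝ (Fin (n + 1)) →L[ℝ] ℝ)
      (E := fun p : M => TangentSpace (𝓡 (n + 1)) p →L[ℝ] TangentSpace (𝓡 (n + 1)) p →L[ℝ] ℝ)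
      z.1 ((g z.2).inner z.1))
    (univ ×ˢ Ico 0 ε)
  isUnitNormal : ∀ t ∈ Ico 0 ε, IsUnitNormal F ν (g t) (N t)
  evolution : ∀ t ∈ Ico 0 ε, ∀ (p : M) (v w : TangentSpace (𝓡 (n + 1)) p),
    HasDerivWithinAt (fun s => (g s).inner p v w)
      (C * (g t).inner p (weingarten (g t) (N t) p v) w) (Ico 0 ε) t

theorem IsEGF.isSecondFormFlow {F : Foliation n M} {ν : VField n M} {C ε : ℝ}
    {f : ℕ → M → ℝ → ℝ} {g : ℝ → RMetric n M} {N : ℝ → VField n M} (hn : 2 ≤ n)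
    (hf₁ : ∀ p t, f 1 p t = C) (hf : ∀ j ≠ 1, ∀ p t, f j p t = 0)
    (h : IsEGF F ν f ε g N) : IsSecondFormFlow F ν C ε g N where
  smooth := h.smooth
  isUnitNormal := h.isUnitNormal
  evolution t ht p v w := by
    have hN := h.isUnitNormal t ht
    have h1 := h.evolution t ht p v w
    -- The index `1` occurs in the sum over `j < n` exactly because `n ≥ 2`.
    rw [Finset.sum_eq_single_of_mem 1 (Finset.mem_range.2 (by omega))
      (fun j _ hj => by rw [hf j hj, zero_mul]), hf₁, bHat_one hN.smooth hN.unit] at h1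
    exact h1

namespace IsSecondFormFlow

variable {F : Foliation n M} {ν : VField n M} {C ε : ℝ} {g : ℝ → RMetric n M} {N : ℝ → VField n M}

/-- `A N = 0`, so the form `C g(A ·, ·)` driving the metric annihilates the normal at each time, as
`unitNormal_const` requires. -/
theorem normal_eq (h : IsSecondFormFlow F ν C ε g N) {t : ℝ} (ht : t ∈ Ico 0 ε) : N t = N 0 := by
  funext p
  obtain ⟨α, hα⟩ := F.exists_ker_isTangent p
  let b : ℝ → EuclideanSpace ℝ (Fin (n + 1)) →L[ℝ] EuclideanSpace ℝ (Fin (n + 1)) →L[ℝ] ℝ :=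
    fun t => C • ((g t).inner p).comp (weingarten (g t) (N t) p)
  refine unitNormal_const (E := EuclideanSpace ℝ (Fin (n + 1))) (g := fun t => (g t).inner p)
    (b := b) (N := fun t => N t p) (ν := ν p) (α := α) (fun t _ u hu => (g t).pos p u hu)
    (fun t ht u v => h.evolution t ht p u v) (fun t ht => (h.isUnitNormal t ht).unit p)
    (fun t ht v hv => (h.isUnitNormal t ht).normal p v (hα v hv))
    (fun t ht => (h.isUnitNormal t ht).pos p) (fun t ht v => ?_) ht
  have h0 (v : TangentSpace (𝓡 (n + 1)) p) :
      C * (g t).inner p (weingarten (g t) (N t) p (N t p)) v = 0 := by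
    rw [weingarten_apply, tangentialPart_normal ((h.isUnitNormal t ht).unit p), map_zero, neg_zero,
      map_zero, zero_apply, mul_zero]
  exact h0 v

theorem evolution' (h : IsSecondFormFlow F ν C ε g N) {t : ℝ} (ht : t ∈ Ico 0 ε) (p : M)
    (v w : TangentSpace (𝓡 (n + 1)) p) :
    HasDerivWithinAt (fun s => (g s).inner p v w)
      (C * (g t).inner p (weingarten (g t) (N 0) p v) w) (Ico 0 ε) t := by
  have := h.evolution t ht p v w
  rwa [h.normal_eq ht] at this

theorem unit (h : IsSecondFormFlow F ν C ε g N) {t : ℝ} (ht : t ∈ Ico 0 ε) (p : M) :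
    (g t).inner p (N 0 p) (N 0 p) = 1 := by
  have := (h.isUnitNormal t ht).unit p
  rwa [h.normal_eq ht] at this

theorem weingarten_normal (h : IsSecondFormFlow F ν C ε g N) {t : ℝ} (ht : t ∈ Ico 0 ε) (p : M) :
    weingarten (g t) (N 0) p (N 0 p) = 0 := by
  rw [weingarten_apply, tangentialPart_normal (h.unit ht p), map_zero, neg_zero]

theorem inner_normal_eq (h : IsSecondFormFlow F ν C ε g N) {t : ℝ} (ht : t ∈ Ico 0 ε) (p : M)
    (v : TangentSpace (𝓡 (n + 1)) p) :
    (g t).inner p (N 0 p) v = (g 0).inner p (N 0 p) v := by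
  refine eq_of_hasDerivWithinAt_zero (f := fun t => (g t).inner p (N 0 p) v) (fun s hs => ?_) ht
  have := h.evolution' hs p (N 0 p) v
  rwa [h.weingarten_normal hs, map_zero, zero_apply, mul_zero] at this

end IsSecondFormFlow

end Evolution

/-! ### Integral curves in charts -/

section CurvesInCharts

variable {E : Type*} [NormedAddCommGroup E] [NormedSpace ℝ E]
  {H : Type*} [TopologicalSpace H] {I : ModelWithCorners ℝ E H}
  {M : Type*} [TopologicalSpace M] [ChartedSpace H M] [IsManifold I ∞ M]

theorem coordFrame_localField (V : (p : M) → TangentSpace I p) {x : M} {y : E}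
    (hy : y ∈ (extChartAt I x).target) :
    coordFrame I x ((extChartAt I x).symm y) (localField I V x y) = V ((extChartAt I x).symm y) :=
  coordFrame_coordMap ((extChartAt I x).map_target hy) _

theorem localField_extChartAt (V : (p : M) → TangentSpace I p) {x p : M}
    (hp : p ∈ (extChartAt I x).source) :
    localField I V x (extChartAt I x p) = coordMap I x p (V p) :=
  congrArg (fun q => (coordMap I x q (V q) : E)) ((extChartAt I x).left_inv hp)

theorem hasDerivWithinAt_extChartAt_comp {V : (p : M) → TangentSpace I p} {x : M} {γ : ℝ → M}
    {S : Set ℝ} {s : ℝ}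
    (hγ : HasMFDerivWithinAt 𝓘(ℝ, ℝ) I γ S s ((1 : ℝ →L[ℝ] ℝ).smulRight (V (γ s))))
    (hs : γ s ∈ (extChartAt I x).source) :
    HasDerivWithinAt (fun r => extChartAt I x (γ r))
      (localField I V x (extChartAt I x (γ s))) S s := by
  have h1 : HasMFDerivAt I 𝓘(ℝ, E) (extChartAt I x) (γ s) (coordMap I x (γ s)) := by
    rw [coordMap, TangentBundle.continuousLinearMapAt_trivializationAt (by simpa using hs)]
    exact (mdifferentiableAt_extChartAt (by simpa using hs)).hasMFDerivAt
  have h2 : HasFDerivWithinAt (fun r => extChartAt I x (γ r))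
      ((1 : ℝ →L[ℝ] ℝ).smulRight (coordMap I x (γ s) (V (γ s)))) S s := by
    refine (h1.comp_hasMFDerivWithinAt s hγ).hasFDerivWithinAt.congr_fderiv ?_
    ext
    change (coordMap I x (γ s) ((1 : ℝ) • V (γ s)) : E) = (1 : ℝ) • coordMap I x (γ s) (V (γ s))
    rw [map_smul]
  rw [localField_extChartAt V hs]
  simpa using h2.hasDerivWithinAt

/-- A curve with vanishing velocity on an interval of times is constant. -/
theorem eq_of_isMIntegralCurveOn_zero {V : (p : M) → TangentSpace I p} {γ : ℝ → M} {S : Set ℝ}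
    (hS : Convex ℝ S) (hγ : IsMIntegralCurveOn γ V S) (hV : ∀ s ∈ S, V (γ s) = 0) {a b : ℝ}
    (ha : a ∈ S) (hb : b ∈ S) : γ a = γ b := by
  refine hS.isPreconnected.induction₂ (fun a b => γ a = γ b) (fun s hs => ?_)
    (fun _ _ _ _ _ _ h1 h2 => h1.trans h2) (fun _ _ _ _ h1 => h1.symm) ha hb
  have hev : ∀ᶠ r in 𝓝[S] s, γ r ∈ (extChartAt I (γ s)).source :=
    (hγ s hs).continuousWithinAt.eventually_mem (extChartAt_source_mem_nhds (γ s))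
  obtain ⟨δ, hδ, hball⟩ := Metric.mem_nhdsWithin_iff.1 hev
  have hconv : Convex ℝ (Metric.ball s δ ∩ S) := (convex_ball s δ).inter hS
  have hconst : ∀ r ∈ Metric.ball s δ ∩ S,
      extChartAt I (γ s) (γ s) = extChartAt I (γ s) (γ r) := by
    intro r hr
    have hder : ∀ r ∈ Metric.ball s δ ∩ S, HasFDerivWithinAt (fun r => extChartAt I (γ s) (γ r))
        (0 : ℝ →L[ℝ] E) (Metric.ball s δ ∩ S) r := by
      intro r hr
      have h1 := hasDerivWithinAt_extChartAt_comp ((hγ r hr.2).mono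
        (inter_subset_right (s := Metric.ball s δ))) (hball hr)
      rw [localField_extChartAt V (hball hr), hV r hr.2, map_zero] at h1
      exact h1.hasFDerivWithinAt.congr_fderiv (by ext; simp)
    have hbound := hconv.norm_image_sub_le_of_norm_hasFDerivWithin_le (C := 0) hder
      (fun _ _ => by simp) ⟨Metric.mem_ball_self hδ, hs⟩ hr
    rw [zero_mul, norm_le_zero_iff, sub_eq_zero] at hbound
    exact hbound.symm
  filter_upwards [inter_mem_nhdsWithin S (Metric.ball_mem_nhds s hδ)] with r hr
  exact (extChartAt I (γ s)).injOn (mem_extChartAt_source (γ s)) (hball ⟨hr.2, hr.1⟩)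
    (hconst r ⟨hr.2, hr.1⟩)

end CurvesInCharts

/-! ### From the manifold to the local flow -/

section LocalWeingarten

variable {n : ℕ} {M : Type*} [TopologicalSpace M]
  [ChartedSpace (EuclideanSpace ℝ (Fin (n + 1))) M] [IsManifold (𝓡 (n + 1)) ∞ M]

/-- The Weingarten operator at `y` in coordinates of the preferred chart at `x`. -/
def localWeingarten (g : RMetric n M) (N : VField n M) (x : M)
    (y : EuclideanSpace ℝ (Fin (n + 1))) :
    EuclideanSpace ℝ (Fin (n + 1)) →L[ℝ] EuclideanSpace ℝ (Fin (n + 1)) :=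
  (coordMap (𝓡 (n + 1)) x ((extChartAt (𝓡 (n + 1)) x).symm y)).comp
    ((weingarten g N ((extChartAt (𝓡 (n + 1)) x).symm y)).comp
      (coordFrame (𝓡 (n + 1)) x ((extChartAt (𝓡 (n + 1)) x).symm y)))

theorem coordFrame_localWeingarten (g : RMetric n M) (N : VField n M) {x : M}
    {y : EuclideanSpace ℝ (Fin (n + 1))} (hy : y ∈ (extChartAt (𝓡 (n + 1)) x).target)
    (u : EuclideanSpace ℝ (Fin (n + 1))) :
    coordFrame (𝓡 (n + 1)) x ((extChartAt (𝓡 (n + 1)) x).symm y) (localWeingarten g N x y u) =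
      weingarten g N _ (coordFrame (𝓡 (n + 1)) x ((extChartAt (𝓡 (n + 1)) x).symm y) u) :=
  coordFrame_coordMap ((extChartAt (𝓡 (n + 1)) x).map_target hy) _

theorem localWeingarten_pow (g : RMetric n M) (N : VField n M) {x : M}
    {y : EuclideanSpace ℝ (Fin (n + 1))} (hy : y ∈ (extChartAt (𝓡 (n + 1)) x).target) (i : ℕ) :
    localWeingarten g N x y ^ i = (coordMap (𝓡 (n + 1)) x ((extChartAt (𝓡 (n + 1)) x).symm y)).comp
      ((weingarten g N ((extChartAt (𝓡 (n + 1)) x).symm y) ^ i).comp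
        (coordFrame (𝓡 (n + 1)) x ((extChartAt (𝓡 (n + 1)) x).symm y))) := by
  have hp := (extChartAt (𝓡 (n + 1)) x).map_target hy
  induction i with
  | zero =>
    ext1 u
    exact (coordMap_coordFrame hp u).symm
  | succ i ih =>
    ext1 u
    rw [pow_succ', pow_succ', ih]
    change coordMap _ _ _ (weingarten g N _ (coordFrame _ _ _ (coordMap _ _ _ _))) =
      coordMap _ _ _ (weingarten g N _ _)
    rw [coordFrame_coordMap hp]
    rfl

theorem traceCLM_localWeingarten_pow (g : RMetric n M) (N : VField n M) {x : M}
    {y : EuclideanSpace ℝ (Fin (n + 1))} (hy : y ∈ (extChartAt (𝓡 (n + 1)) x).target) (i : ℕ) :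
    traceCLM _ (localWeingarten g N x y ^ i) =
      LinearMap.trace ℝ (TangentSpace (𝓡 (n + 1)) ((extChartAt (𝓡 (n + 1)) x).symm y))
        (weingarten g N ((extChartAt (𝓡 (n + 1)) x).symm y) ^ i).toLinearMap := by
  have hp := (extChartAt (𝓡 (n + 1)) x).map_target hy
  have : FiniteDimensional ℝ (TangentSpace (𝓡 (n + 1)) ((extChartAt (𝓡 (n + 1)) x).symm y)) :=
    inferInstanceAs (FiniteDimensional ℝ (EuclideanSpace ℝ (Fin (n + 1))))
  rw [localWeingarten_pow g N hy, traceCLM_apply]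
  refine (LinearMap.trace_comp_comm'
    ((weingarten g N ((extChartAt (𝓡 (n + 1)) x).symm y) ^ i).comp
      (coordFrame (𝓡 (n + 1)) x ((extChartAt (𝓡 (n + 1)) x).symm y))).toLinearMap
    (coordMap (𝓡 (n + 1)) x ((extChartAt (𝓡 (n + 1)) x).symm y)).toLinearMap).trans ?_
  congr 1
  ext1 v
  change (weingarten g N _ ^ i) (coordFrame _ _ _ (coordMap _ _ _ v)) = (weingarten g N _ ^ i) v
  rw [coordFrame_coordMap hp]

variable {F : Foliation n M} {ν : VField n M} {C ε : ℝ} {g : ℝ → RMetric n M} {N : ℝ → VField n M}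

/-- The frame carries each identity on `M` to its coordinate form. In the Koszul condition the
vectors are orthogonal to `N`, so the tangential projection in `A` drops out and `A = -∇N` on them.
-/
theorem IsSecondFormFlow.isLocalFlow (h : IsSecondFormFlow F ν C ε g N) (hε : 0 < ε) (x : M) :
    IsLocalFlow (extChartAt (𝓡 (n + 1)) x).target ε C
      (fun z => localBilin (𝓡 (n + 1)) (g z.2).inner x z.1) (localField (𝓡 (n + 1)) (N 0) x)
      (fun z => localWeingarten (g z.2) (N 0) x z.1) := by
  have hN0 := (h.isUnitNormal 0 ⟨le_rfl, hε⟩).smooth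
  have hsm := contDiffOn_localBilin (I := 𝓡 (n + 1)) (β := fun t => (g t).inner) h.smooth x
  have hopen := isOpen_extChartAt_target (I := 𝓡 (n + 1)) x
  refine ⟨hopen, hsm, contDiffOn_localField hN0, ?_, ?_, ?_, ?_, ?_, ?_, ?_⟩
  · intro z _ u v
    exact (g z.2).symm _ _ _
  · intro z hz u hu
    refine (g z.2).pos _ _ fun h0 => hu ?_
    change coordFrame (𝓡 (n + 1)) x ((extChartAt (𝓡 (n + 1)) x).symm z.1) u = 0 at h0
    rw [← coordMap_coordFrame ((extChartAt (𝓡 (n + 1)) x).map_target hz.1) u, h0, map_zero]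
  · intro z hz
    simp only [localBilin_apply]
    rw [coordFrame_localField _ hz.1]
    exact h.unit hz.2 _
  · intro z hz
    ext v
    simp only [localBilin_apply]
    rw [coordFrame_localField _ hz.1]
    exact h.inner_normal_eq hz.2 _ _
  · intro z hz u v
    simp only [localBilin_apply]
    rw [coordFrame_localWeingarten _ _ hz.1]
    exact h.evolution' hz.2 _ _ _
  · intro z hz
    simp only [localWeingarten, ContinuousLinearMap.comp_apply]
    rw [coordFrame_localField _ hz.1, h.weingarten_normal hz.2, map_zero]
  · intro z hz u v hu hv
    have hd : DifferentiableAt ℝ (localBilin (𝓡 (n + 1)) (g z.2).inner x) z.1 :=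
      (fderivWithin_prod_fst hopen hz (hsm.differentiableOn (by simp) z hz)).differentiableAt
    have hk := inner_leviCivita_coordFrame (g z.2) hN0 hz.1 hd u v
    simp only [localBilin_apply] at hu hv
    rw [coordFrame_localField _ hz.1] at hu hv
    change _ = -(fderiv ℝ (localBilin (𝓡 (n + 1)) (g z.2).inner x) z.1 _ u v
      + localBilin (𝓡 (n + 1)) (g z.2).inner x z.1 _ v
      + localBilin (𝓡 (n + 1)) (g z.2).inner x z.1 u _)
    rw [← hk]
    simp only [localBilin_apply]
    rw [coordFrame_localWeingarten _ _ hz.1, coordFrame_localWeingarten _ _ hz.1, weingarten_apply,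
      weingarten_apply, tangentialPart_of_inner_eq_zero hu, tangentialPart_of_inner_eq_zero hv]
    simp only [map_neg, neg_apply]
    ring

end LocalWeingarten

/-! ### Completeness of smooth fields on compact manifolds -/

section Completeness

variable {E : Type*} [NormedAddCommGroup E] [NormedSpace ℝ E] [CompleteSpace E]
  {H : Type*} [TopologicalSpace H] {I : ModelWithCorners ℝ E H} [I.Boundaryless]
  {M : Type*} [TopologicalSpace M] [ChartedSpace H M] [IsManifold I ∞ M]

/-- Integral curves of a smooth vector field exist for a uniform time near each point. -/
theorem exists_uniform_isMIntegralCurveOn {V : (p : M) → TangentSpace I p}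
    (hV : ContMDiff I I.tangent ∞ (fun p => (⟨p, V p⟩ : TangentBundle I M))) (x : M) :
    ∃ U ∈ 𝓝 x, ∃ δ > 0, ∀ p ∈ U, ∃ γ : ℝ → M, γ 0 = p ∧ IsMIntegralCurveOn γ V (Ioo (-δ) δ) := by
  classical
  have htgt := (isOpen_extChartAt_target (I := I) x).mem_nhds (mem_extChartAt_target x)
  set y₀ := extChartAt I x x with hy₀
  have hVl : ContDiffAt ℝ ∞ (localField I V x) y₀ := (contDiffOn_localField hV).contDiffAt htgt
  have hbd : ∀ᶠ y in 𝓝 y₀, ‖localField I V x y‖ < ‖localField I V x y₀‖ + 1 :=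
    hVl.continuousAt.norm.eventually_lt continuousAt_const (by simp)
  obtain ⟨ρ, hρ, hball⟩ := Metric.mem_nhds_iff.1 (inter_mem htgt hbd)
  set K := ‖localField I V x y₀‖ + 1 with hK
  have hKpos : 0 < K := by positivity
  -- cutting the field off outside a ball keeps the solutions in the chart
  set f : E → E := fun y => if y ∈ Metric.ball y₀ ρ then localField I V x y else 0 with hf
  have hfbd (y : E) : ‖f y‖ ≤ K := by
    by_cases h : y ∈ Metric.ball y₀ ρ
    · simp only [hf, if_pos h]
      exact (hball h).2.le
    · simp only [hf, if_neg h, norm_zero]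
      exact hKpos.le
  have hfsmooth : ContDiffAt ℝ 1 f y₀ := by
    refine (hVl.of_le (by simp)).congr_of_eventuallyEq ?_
    filter_upwards [Metric.ball_mem_nhds y₀ hρ] with y hy
    simp only [hf, if_pos hy]
  obtain ⟨r, hr, δ, hδ, hsol⟩ :=
    hfsmooth.exists_forall_mem_closedBall_exists_eq_forall_mem_Ioo_hasDerivAt 0
  -- With speed at most `K`, a solution starting within `ρ / 2` of the centre moves less than `ρ /
  -- 2` in time `ρ / (2 * K)`, hence stays in the ball where the field is not cut off.
  have hδ' : 0 < min δ (ρ / (2 * K)) := lt_min hδ (by positivity)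
  have hr' : 0 < min r (ρ / 2) := lt_min hr (by positivity)
  refine ⟨(extChartAt I x).source ∩ extChartAt I x ⁻¹' Metric.ball y₀ (min r (ρ / 2)), ?_,
    min δ (ρ / (2 * K)), hδ', fun p hp => ?_⟩
  · exact inter_mem (extChartAt_source_mem_nhds x)
      ((continuousAt_extChartAt x).preimage_mem_nhds (Metric.ball_mem_nhds _ hr'))
  obtain ⟨α, hα0, hα⟩ := hsol (extChartAt I x p)
    (Metric.ball_subset_closedBall (Metric.ball_subset_ball (min_le_left _ _) hp.2))
  simp only [zero_sub, zero_add] at hα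
  have hαball (t : ℝ) (ht : t ∈ Ioo (-min δ (ρ / (2 * K))) (min δ (ρ / (2 * K)))) :
      α t ∈ Metric.ball y₀ ρ := by
    have hsub : Ioo (-min δ (ρ / (2 * K))) (min δ (ρ / (2 * K))) ⊆ Ioo (-δ) δ :=
      Ioo_subset_Ioo (neg_le_neg (min_le_left _ _)) (min_le_left _ _)
    have h1 := (convex_Ioo (-min δ (ρ / (2 * K))) (min δ (ρ / (2 * K)))
      ).norm_image_sub_le_of_norm_hasDerivWithin_le (f := α) (C := K)
      (fun s hs => (hα s (hsub hs)).hasDerivWithinAt) (fun s _ => hfbd _)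
      (show (0 : ℝ) ∈ _ from ⟨neg_lt_zero.2 hδ', hδ'⟩) ht
    rw [hα0, sub_zero, Real.norm_eq_abs] at h1
    have h2 : |t| < ρ / (2 * K) := (abs_lt.2 ht).trans_le (min_le_right _ _)
    have h3 : K * |t| < ρ / 2 := by
      calc K * |t| < K * (ρ / (2 * K)) := by gcongr
        _ = ρ / 2 := by field_simp
    have h4 : dist (extChartAt I x p) y₀ < ρ / 2 := lt_of_lt_of_le hp.2 (min_le_right _ _)
    rw [Metric.mem_ball]
    calc dist (α t) y₀ ≤ dist (α t) (extChartAt I x p) + dist (extChartAt I x p) y₀ :=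
          dist_triangle _ _ _
      _ < ρ / 2 + ρ / 2 := add_lt_add (by rw [dist_eq_norm]; exact h1.trans_lt h3) h4
      _ = ρ := by ring
  refine ⟨fun t => (extChartAt I x).symm (α t), ?_, fun t ht => ?_⟩
  · simp only [hα0]
    exact (extChartAt I x).left_inv hp.1
  · have hmem := hαball t ht
    have htarget : α t ∈ (extChartAt I x).target := (hball hmem).1
    have h1 := hα t ⟨(neg_le_neg (min_le_left _ _)).trans_lt ht.1, ht.2.trans_le (min_le_left _ _)⟩
    simp only [hf, if_pos hmem] at h1
    have h2 := ((contMDiffAt_extChartAt_symm htarget).mdifferentiableAt (by simp)).hasMFDerivAt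
    rw [mfderiv_extChartAt_symm htarget] at h2
    have h3 := h2.comp t h1.hasFDerivAt.hasMFDerivAt
    refine HasMFDerivAt.hasMFDerivWithinAt ?_
    refine HasMFDerivAt.congr_mfderiv (f := fun t => (extChartAt I x).symm (α t)) h3 ?_
    ext
    symm
    change (1 : ℝ) • V ((extChartAt I x).symm (α t)) =
      coordFrame I x _ ((1 : ℝ) • localField I V x (α t))
    rw [map_smul, coordFrame_localField V htarget]

/-- Smooth vector fields on compact manifolds are complete. -/
theorem isCompleteField_of_compactSpace [T2Space M] [CompactSpace M]
    {V : (p : M) → TangentSpace I p}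
    (hV : ContMDiff I I.tangent ∞ (fun p => (⟨p, V p⟩ : TangentBundle I M))) :
    IsCompleteField V := by
  obtain ⟨δ, hδ, h⟩ : ∃ δ > 0, ∀ p ∈ (univ : Set M), ∃ γ : ℝ → M, γ 0 = p ∧
      IsMIntegralCurveOn γ V (Ioo (-δ) δ) := by
    -- Having a common existence time passes to subsets and to finite unions, so by compactness it
    -- is enough to have it locally.
    refine isCompact_univ.induction_on ⟨1, one_pos, by simp⟩ ?_ ?_ ?_
    · rintro s t hst ⟨δ, hδ, h⟩
      exact ⟨δ, hδ, fun p hp => h p (hst hp)⟩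
    · rintro s t ⟨δ, hδ, h⟩ ⟨δ', hδ', h'⟩
      have hmono {a b : ℝ} (hab : a ≤ b) : Ioo (-a) a ⊆ Ioo (-b) b :=
        Ioo_subset_Ioo (neg_le_neg hab) hab
      refine ⟨min δ δ', lt_min hδ hδ', fun p hp => ?_⟩
      rcases hp with hp | hp
      · obtain ⟨γ, h0, hγ⟩ := h p hp
        exact ⟨γ, h0, hγ.mono (hmono (min_le_left _ _))⟩
      · obtain ⟨γ, h0, hγ⟩ := h' p hp
        exact ⟨γ, h0, hγ.mono (hmono (min_le_right _ _))⟩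
    · intro x _
      obtain ⟨U, hU, δ, hδ, h⟩ := exists_uniform_isMIntegralCurveOn hV x
      exact ⟨U, mem_nhdsWithin_of_mem_nhds hU, δ, hδ, h⟩
  intro p
  exact exists_isMIntegralCurve_of_isMIntegralCurveOn (hV.of_le (by simp)) hδ
    (fun p => h p (mem_univ p)) p

end Completeness

/-! ### Constancy of the power sums along `∂_t + (C/2) N` -/

section SpaceTime

variable {n : ℕ} {M : Type*} [TopologicalSpace M]
  [ChartedSpace (EuclideanSpace ℝ (Fin (n + 1))) M]

/-- The orbits are explicit: the integral curve of `N` reparametrized by the factor `C / 2`, paired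
with translation in time. -/
theorem exists_isFlow_spaceTimeField (C : ℝ) {N : VField n M} (hN : IsCompleteField N) :
    ∃ φ : ℝ → M × ℝ → M × ℝ, IsFlow (spaceTimeField C N) φ := by
  choose γ hγ0 hγ using hN
  refine ⟨fun s z => (γ z.1 (s * (C / 2)), z.2 + s), ⟨fun z => ?_, fun z s => ?_⟩⟩
  · simp [hγ0]
  · have h1 := (hγ z.1).comp_mul (C / 2) s
    have h2 : HasMFDerivAt 𝓘(ℝ, ℝ) 𝓘(ℝ, ℝ) (fun s : ℝ => z.2 + s) s
        ((1 : ℝ →L[ℝ] ℝ).smulRight (1 : ℝ)) :=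
      ((hasDerivAt_id s).const_add z.2).hasFDerivAt.hasMFDerivAt
    refine (h1.prodMk h2).congr_mfderiv ?_
    exact ContinuousLinearMap.ext fun r => rfl

variable {C : ℝ}

theorem isMIntegralCurveOn_fst {N : VField n M} {Γ : ℝ → M × ℝ} {S : Set ℝ}
    (hΓ : IsMIntegralCurveOn Γ (spaceTimeField C N) S) :
    IsMIntegralCurveOn (fun s => (Γ s).1) (fun p => (C / 2) • N p) S := by
  intro s hs
  refine ((hasMFDerivAt_fst (x := Γ s)).comp_hasMFDerivWithinAt s (hΓ s hs)).congr_mfderiv ?_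
  ext
  rfl

theorem hasDerivWithinAt_snd {N : VField n M} {Γ : ℝ → M × ℝ} {S : Set ℝ}
    (hΓ : IsMIntegralCurveOn Γ (spaceTimeField C N) S) {s : ℝ} (hs : s ∈ S) :
    HasDerivWithinAt (fun s => (Γ s).2) 1 S s := by
  have h : HasFDerivWithinAt (fun s => (Γ s).2) ((1 : ℝ →L[ℝ] ℝ).smulRight (1 : ℝ)) S s := by
    refine ((hasMFDerivAt_snd (x := Γ s)).comp_hasMFDerivWithinAt s
      (hΓ s hs)).hasFDerivWithinAt.congr_fderiv ?_
    ext
    rfl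
  simpa using h.hasDerivWithinAt

theorem snd_eq_add {N : VField n M} {Γ : ℝ → M × ℝ} {t : ℝ}
    (hΓ : IsMIntegralCurveOn Γ (spaceTimeField C N) (Icc (-t) 0)) {p : M} (h0 : Γ 0 = (p, t))
    {s : ℝ} (hs : s ∈ Icc (-t) 0) : (Γ s).2 = t + s := by
  have hder : ∀ r ∈ Icc (-t) 0, HasFDerivWithinAt (fun s => (Γ s).2 - s) (0 : ℝ →L[ℝ] ℝ)
      (Icc (-t) 0) r := fun r hr => by
    refine ((hasDerivWithinAt_snd hΓ hr).sub
      (hasDerivWithinAt_id r _)).hasFDerivWithinAt.congr_fderiv ?_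
    ext
    simp
  have h := (convex_Icc (-t) 0).norm_image_sub_le_of_norm_hasFDerivWithin_le (C := 0) hder
    (fun _ _ => by simp) (⟨hs.1.trans hs.2, le_rfl⟩ : (0 : ℝ) ∈ Icc (-t) 0) hs
  rw [zero_mul, norm_le_zero_iff, sub_eq_zero, h0] at h
  linarith

variable [IsManifold (𝓡 (n + 1)) ∞ M] {F : Foliation n M} {ν : VField n M} {ε : ℝ}
  {g : ℝ → RMetric n M} {N : ℝ → VField n M}

theorem IsSecondFormFlow.powerSum_succ_eq (h : IsSecondFormFlow F ν C ε g N) {t : ℝ}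
    (ht : t ∈ Ico 0 ε) {x p : M} (hp : p ∈ (extChartAt (𝓡 (n + 1)) x).source) (i : ℕ) :
    powerSum (g t) (N t) (i + 1) p =
      traceCLM _ (localWeingarten (g t) (N 0) x (extChartAt (𝓡 (n + 1)) x p) ^ (i + 1)) := by
  rw [h.normal_eq ht, traceCLM_localWeingarten_pow _ _ ((extChartAt (𝓡 (n + 1)) x).map_source hp),
    ← powerSum_succ (h.unit ht _), (extChartAt (𝓡 (n + 1)) x).left_inv hp]

/-- The power sums are constant along the integral curves of `∂_t + (C/2) N`. -/
theorem IsSecondFormFlow.powerSum_eq_of_ne_zero (h : IsSecondFormFlow F ν C ε g N) (hC : C ≠ 0)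
    {t : ℝ} (ht : t ∈ Ico 0 ε) {p : M} {Γ : ℝ → M × ℝ} (h0 : Γ 0 = (p, t))
    (hΓ : IsMIntegralCurveOn Γ (spaceTimeField C (N 0)) (Icc (-t) 0)) (i : ℕ) :
    powerSum (g t) (N t) (i + 1) p = powerSum (g 0) (N 0) (i + 1) (Γ (-t)).1 := by
  have hε : 0 < ε := ht.1.trans_lt ht.2
  rcases ht.1.eq_or_lt with rfl | htpos
  · rw [neg_zero, h0]
  have hsnd (s) (hs : s ∈ Icc (-t) 0) := snd_eq_add hΓ h0 hs
  have htime (s) (hs : s ∈ Icc (-t) 0) : (Γ s).2 ∈ Ico 0 ε := by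
    rw [hsnd s hs]
    exact ⟨by linarith [hs.1], by linarith [hs.2, ht.2]⟩
  have hfst := isMIntegralCurveOn_fst hΓ
  set τ : ℝ → ℝ := fun s => powerSum (g (Γ s).2) (N (Γ s).2) (i + 1) (Γ s).1 with hτ
  -- the curve in the chart at the point `(Γ s).1`
  let z (s r : ℝ) : EuclideanSpace ℝ (Fin (n + 1)) × ℝ :=
    (extChartAt (𝓡 (n + 1)) (Γ s).1 (Γ r).1, (Γ r).2)
  have hev (s) (hs : s ∈ Icc (-t) 0) : ∀ᶠ r in 𝓝[Icc (-t) 0] s,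
      (Γ r).1 ∈ (extChartAt (𝓡 (n + 1)) (Γ s).1).source :=
    (hfst s hs).continuousWithinAt.eventually_mem (extChartAt_source_mem_nhds (Γ s).1)
  have hz (s) (hs : s ∈ Icc (-t) 0) : HasDerivWithinAt (z s)
      ((C / 2) • localField (𝓡 (n + 1)) (N 0) (Γ s).1 (z s s).1, 1) (Icc (-t) 0) s := by
    have h1 := hasDerivWithinAt_extChartAt_comp (V := fun p => (C / 2) • N 0 p) (hfst s hs)
      (mem_extChartAt_source (I := 𝓡 (n + 1)) (Γ s).1)
    have h2 : localField (𝓡 (n + 1)) (fun p => (C / 2) • N 0 p) (Γ s).1 (z s s).1 =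
        (C / 2) • localField (𝓡 (n + 1)) (N 0) (Γ s).1 (z s s).1 := map_smul _ _ _
    exact (h1.congr_deriv h2).prodMk (hasDerivWithinAt_snd hΓ hs)
  have hτz (s) (hs : s ∈ Icc (-t) 0) : τ =ᶠ[𝓝[Icc (-t) 0] s] fun r => traceCLM _
      (localWeingarten (g (z s r).2) (N 0) (Γ s).1 (z s r).1 ^ (i + 1)) := by
    filter_upwards [hev s hs, self_mem_nhdsWithin] with r hr hr'
    exact h.powerSum_succ_eq (htime r hr') hr i
  -- At `s = -t` the orbit reaches the boundary time `0`, where the derivative computation is not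
  -- available. Continuity up to the endpoints suffices for the mean value theorem.
  have hcont : ContinuousOn τ (Icc (-t) 0) := by
    intro s hs
    have hl := (h.isLocalFlow hε (Γ s).1).continuousOn_trace_pow hC (i + 1)
    have hzs : z s s ∈ (extChartAt (𝓡 (n + 1)) (Γ s).1).target ×ˢ Ico 0 ε :=
      ⟨mem_extChartAt_target (Γ s).1, htime s hs⟩
    have hmaps : Tendsto (z s) (𝓝[Icc (-t) 0] s)
        (𝓝[(extChartAt (𝓡 (n + 1)) (Γ s).1).target ×ˢ Ico 0 ε] (z s s)) := by
      refine tendsto_nhdsWithin_iff.2 ⟨(hz s hs).continuousWithinAt, ?_⟩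
      filter_upwards [hev s hs, self_mem_nhdsWithin] with r hr hr'
      exact ⟨(extChartAt (𝓡 (n + 1)) (Γ s).1).map_source hr, htime r hr'⟩
    exact ContinuousWithinAt.congr_of_eventuallyEq ((hl (z s s) hzs).tendsto.comp hmaps)
      (hτz s hs) ((hτz s hs).self_of_nhdsWithin hs)
  have hder : ∀ s ∈ Ioo (-t) 0, HasDerivAt τ 0 s := by
    intro s hs
    have hs' := Ioo_subset_Icc_self hs
    have hnhds : Icc (-t) 0 ∈ 𝓝 s := Icc_mem_nhds hs.1 hs.2
    have hzs : z s s ∈ (extChartAt (𝓡 (n + 1)) (Γ s).1).target ×ˢ Ioo 0 ε := by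
      refine ⟨mem_extChartAt_target (Γ s).1, ?_, (htime s hs').2⟩
      change 0 < (Γ s).2
      rw [hsnd s hs']
      linarith [hs.1]
    have h1 := (h.isLocalFlow hε (Γ s).1).hasDerivAt_trace_pow hC
      ((hz s hs').hasDerivAt hnhds) hzs i
    refine h1.congr_of_eventuallyEq ?_
    have h2 := hτz s hs'
    rwa [nhdsWithin_eq_nhds.2 hnhds] at h2
  obtain ⟨c, -, hc⟩ := exists_hasDerivAt_eq_slope τ (fun _ => 0) (neg_lt_zero.2 htpos) hcont hder
  have h1 : τ 0 = τ (-t) := by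
    have : (0 : ℝ) - -t ≠ 0 := by linarith
    rw [eq_comm, div_eq_zero_iff, or_iff_left this, sub_eq_zero] at hc
    exact hc
  have hlast : (Γ (-t)).2 = 0 := by
    rw [hsnd (-t) ⟨le_rfl, by linarith⟩, add_neg_cancel]
  simp only [hτ, hlast] at h1
  rw [h0] at h1
  exact h1

theorem IsSecondFormFlow.metric_eq (h : IsSecondFormFlow F ν 0 ε g N) {t : ℝ} (ht : t ∈ Ico 0 ε) :
    g t = g 0 := by
  have h1 : (g t).inner = (g 0).inner := by
    funext p
    ext v w
    refine eq_of_hasDerivWithinAt_zero (f := fun t => (g t).inner p v w)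
      (fun s hs => ?_) ht
    simpa using h.evolution s hs p v w
  generalize g t = a at h1
  generalize g 0 = b at h1
  cases a
  cases b
  cases h1
  rfl

theorem IsSecondFormFlow.powerSum_eq (h : IsSecondFormFlow F ν C ε g N)
    {t : ℝ} (ht : t ∈ Ico 0 ε) {p : M} {Γ : ℝ → M × ℝ} (h0 : Γ 0 = (p, t))
    (hΓ : IsMIntegralCurveOn Γ (spaceTimeField C (N 0)) (Icc (-t) 0)) (i : ℕ) :
    powerSum (g t) (N t) i p = powerSum (g 0) (N 0) i (Γ (-t)).1 := by
  have hε : (0 : ℝ) ∈ Ico 0 ε := ⟨le_rfl, ht.1.trans_lt ht.2⟩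
  cases i with
  | zero =>
    rw [powerSum_zero ((h.isUnitNormal t ht).unit p), powerSum_zero ((h.isUnitNormal 0 hε).unit _)]
  | succ i =>
    rcases eq_or_ne C 0 with rfl | hC
    -- For `C = 0` the orbit does not move in `M`, and the metric is constant in time as well.
    · have hconst : (Γ 0).1 = (Γ (-t)).1 :=
        eq_of_isMIntegralCurveOn_zero (convex_Icc (-t) 0) (isMIntegralCurveOn_fst hΓ)
          (fun s _ => by simp) ⟨neg_nonpos.2 ht.1, le_rfl⟩ ⟨le_rfl, neg_nonpos.2 ht.1⟩
      rw [h.metric_eq ht, h.normal_eq ht, ← hconst, h0]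
    · exact h.powerSum_eq_of_ne_zero hC ht h0 hΓ i

end SpaceTime

end EGF

end

theorem corollary3 {n : ℕ} (hn : 2 ≤ n) {M : Type*} [TopologicalSpace M] [T2Space M]
    [ChartedSpace (EuclideanSpace ℝ (Fin (n + 1))) M] [IsManifold (𝓡 (n + 1)) ∞ M]
    (F : EGF.Foliation n M) (ν : EGF.VField n M) (hν : EGF.IsTransverseOrientation F ν)
    (C : ℝ) (f : ℕ → M → ℝ → ℝ) (hf₁ : ∀ p t, f 1 p t = C) (hf : ∀ j ≠ 1, ∀ p t, f j p t = 0)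
    (ε : ℝ) (hε : 0 < ε) (g : ℝ → EGF.RMetric n M) (N : ℝ → EGF.VField n M)
    (hg : EGF.IsEGF F ν f ε g N) :
    -- `τ_i^t = τ_i^0 ∘ φ_{-t}` for the flow `φ` of `∂_t + (C/2) N`, which maps `M × {t}` to `M × {0}`
    (∀ φ : ℝ → M × ℝ → M × ℝ, EGF.IsFlow (EGF.spaceTimeField C (N 0)) φ →
      ∀ t ∈ Set.Ico 0 ε, ∀ p : M, (φ (-t) (p, t)).2 = 0 ∧
        ∀ i : ℕ, EGF.powerSum (g t) (N t) i p
          = EGF.powerSum (g 0) (N 0) i (φ (-t) (p, t)).1) ∧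
    -- the same for the local flow, wherever it is defined, without completeness
    (∀ t ∈ Set.Ico 0 ε, ∀ (p : M) (Γ : ℝ → M × ℝ), Γ 0 = (p, t) →
      IsMIntegralCurveOn Γ (EGF.spaceTimeField C (N 0)) (Set.Icc (-t) 0) →
        (Γ (-t)).2 = 0 ∧
        ∀ i : ℕ, EGF.powerSum (g t) (N t) i p = EGF.powerSum (g 0) (N 0) i (Γ (-t)).1) ∧
    -- if `M` is compact or `N` is complete, the flow exists, and constant power sums stay constant
    ((CompactSpace M ∨ EGF.IsCompleteField (N 0)) →
      (∃ φ : ℝ → M × ℝ → M × ℝ, EGF.IsFlow (EGF.spaceTimeField C (N 0)) φ) ∧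
      ∀ (i : ℕ) (c : ℝ), (∀ p, EGF.powerSum (g 0) (N 0) i p = c) →
        ∀ t ∈ Set.Ico 0 ε, ∀ p, EGF.powerSum (g t) (N t) i p = c) := by
  have h := hg.isSecondFormFlow hn hf₁ hf
  have hlocal : ∀ t ∈ Set.Ico 0 ε, ∀ (p : M) (Γ : ℝ → M × ℝ), Γ 0 = (p, t) →
      IsMIntegralCurveOn Γ (EGF.spaceTimeField C (N 0)) (Set.Icc (-t) 0) →
        (Γ (-t)).2 = 0 ∧
        ∀ i : ℕ, EGF.powerSum (g t) (N t) i p = EGF.powerSum (g 0) (N 0) i (Γ (-t)).1 := by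
    intro t ht p Γ h0 hΓ
    refine ⟨?_, h.powerSum_eq ht h0 hΓ⟩
    rw [EGF.snd_eq_add hΓ h0 ⟨le_rfl, neg_nonpos.2 ht.1⟩, add_neg_cancel]
  have hglobal : ∀ φ : ℝ → M × ℝ → M × ℝ, EGF.IsFlow (EGF.spaceTimeField C (N 0)) φ →
      ∀ t ∈ Set.Ico 0 ε, ∀ p : M, (φ (-t) (p, t)).2 = 0 ∧
        ∀ i : ℕ, EGF.powerSum (g t) (N t) i p
          = EGF.powerSum (g 0) (N 0) i (φ (-t) (p, t)).1 :=
    -- A global orbit, restricted to `[-t, 0]`, is a case of the local statement.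
    fun φ hφ t ht p => hlocal t ht p (fun s => φ s (p, t)) (hφ.zero _)
      ((hφ.orbit (p, t)).isMIntegralCurveOn _)
  refine ⟨hglobal, hlocal, fun hcomplete => ?_⟩
  have hN : EGF.IsCompleteField (N 0) := by
    rcases hcomplete with hM | hN
    · exact EGF.isCompleteField_of_compactSpace (hg.isUnitNormal 0 ⟨le_rfl, hε⟩).smooth
    · exact hN
  obtain ⟨φ, hφ⟩ := EGF.exists_isFlow_spaceTimeField C hN
  refine ⟨⟨φ, hφ⟩, fun i c hc t ht p => ?_⟩
  rw [(hglobal φ hφ t ht p).2 i, hc]
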